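/- Let $\mathcal L=\{P,L,I\}$ with $P,L$ unary and $I$ binary. An incidence structure is an $\mathcal L$-structure in which $P$ (points) and $L$ (lines) partition the domain and $I(x,y)$ holds only if $x$ is a point and $y$ is a line. It is $K_{m,n}$-free if there are no $m$ distinct points all incident to the same $n$ distinct lines. Let $T^p_{m,n}$ be the theory of $K_{m,n}$-free incidence structures, and let $T^c_{m,n}$ be the theory of those in which, moreover, any $m$ distinct points lie simultaneously on exactly $n-1$ lines and any $n$ distinct lines intersect in exactly $m-1$ points. For a finite structure $A$ whose elements are bijectively labelled by variables $\bar z$, its diagram is the conjunction of all atomic and negated atomic formulas in $\bar z$ that hold in $A$. A diagram $\Delta(\bar x;\bar y)$ of a finite $A\models T^p_{m,n}$ labelled by $\bar x\bar y$ is safe if every $y_i$ that is a point is incident to at most $n-1$ of the lines among $\bar x$, and every $y_i$ that is a line is incident to at most $m-1$ of the points among $\bar x$; let $\widehat\Delta(\bar x)$ be the part of $\Delta$ that mentions only variables in $\bar x$. Let $$T_{m,n}=T^c_{m,n}\cup\{\forall\bar x\,(\widehat\Delta(\bar x)\to\exists\bar y\,\Delta(\bar x;\bar y)) : \Delta\text{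 a safe diagram}\}.$$ Let $\Gamma$ be the incidence structure with points $a_1,b,w_1,\dots,w_{m-1}$, lines $a_2,c_1,\dots,c_{n-1},z$ and incidences $(a_1,z)$, $(b,z)$ and $(w_i,a_2)$, $(w_i,c_j)$, $(w_i,z)$ for $1\le i\le m-1$, $1\le j\le n-1$. Let $\varphi(x_1,x_2;y_1,\dots,y_n)$ be the formula saying that there are $w_1,\dots,w_{m-1},z$ such that $(x_1,x_2,y_1,y_2,\dots,y_n,w_1,\dots,w_{m-1},z)$ satisfies the diagram of $\Gamma$ labelled as $(a_1,a_2,b,c_1,\dots,c_{n-1},w_1,\dots,w_{m-1},z)$. For a theory $T$ and a formula $\psi(\bar x;\bar y)$ in finite tuples of variables, with parameters taken in a model of $T$ (a set of formulas being consistent if it is finitely satisfiable in that model, and a family of formulas being $k$-inconsistent if no $k$ of its members with distinct indices have a common solution): - $\psi$ has the tree property if for some model of $T$, some $k\ge 2$ and some parameters $(a_s)_{s\in\omega^{<\omega}}$, the set $\{\psi(\bar x;a_{\eta|i}):i<\omega\}$ is consistent for every $\eta\in\omega^\omega$ and $(\psi(\bar x;a_{s^\frown i}))_{i<\omega}$ is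 $k$-inconsistent for every $s\in\omega^{<\omega}$; $T$ is simple if no formula has the tree property. - $\psi$ has SOP$_1$ if for some model of $T$ and some parameters $(a_s)_{s\in 2^{<\omega}}$, the set $\{\psi(\bar x;a_{\eta|i}):i<\omega\}$ is consistent for every $\eta\in 2^\omega$, and $\{\psi(\bar x;a_\nu),\psi(\bar x;a_{\eta^\frown 1})\}$ is inconsistent whenever $\nu$ extends $\eta^\frown 0$; $T$ is NSOP$_1$ if no formula has SOP$_1$. $T$ is properly NSOP$_1$ if it is NSOP$_1$ and not simple. - $\psi$ has TP$_2$ in $T$ if for some model of $T$, some $k\ge2$ and some array $(a_{i,j})_{i,j<\omega}$ of parameters, each row $(\psi(\bar x;a_{i,j}))_{j<\omega}$ is $k$-inconsistent and $\{\psi(\bar x;a_{i,\sigma(i)}):i<\omega\}$ is consistent for every $\sigma:\omega\to\omega$. **Theorem.** Let $m,n\ge 2$. Then $T_{m,n}$ is not simple; moreover it is properly NSOP$_1$; and the formula $\varphi(x_1,x_2;y_1,\dots,y_n)$ has TP$_2$ in $T_{m,n}$. -/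

import Mathlib

open FirstOrder FirstOrder.Language

noncomputable section

/-! ### Classification-theoretic notions for a first-order theory

`FinConsistent φ a` says that the partial type `{φ(x; a i) | i}` over the structure `M` is
consistent (with the elementary diagram of `M`), i.e. finitely satisfiable in `M`.
`KInconsistent k φ a` says that the family `φ(x; a i)` is `k`-inconsistent: no `k` of its
members (with distinct indices) have a common solution. -/

namespace Classification

variable {L : FirstOrder.Language.{0, 0}}

/-- Every finite subfamily of `(φ(x; a i))_i` has a common solution in `M`. -/
def FinConsistent {M : Type} [L.Structure M] {α β ι : Type}
    (φ : L.Formula (α ⊕ β)) (a : ι → β → M) : Prop :=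
  ∀ s : Finset ι, ∃ x : α → M, ∀ i ∈ s, φ.Realize (Sum.elim x (a i))

/-- No `k` members of the family `(φ(x; a i))_i` have a common solution in `M`. -/
def KInconsistent {M : Type} [L.Structure M] {α β ι : Type} (k : ℕ)
    (φ : L.Formula (α ⊕ β)) (a : ι → β → M) : Prop :=
  ∀ s : Finset ι, s.card = k → ¬ ∃ x : α → M, ∀ i ∈ s, φ.Realize (Sum.elim x (a i))

/-- `φ(x; y)` has the tree property in `T`: there are a model of `T`, a tree of parameters
indexed by `ω^{<ω}` and some `k ≥ 2` such that along each branch the instances of `φ` are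
consistent, and the instances of `φ` at the immediate successors of a node are
`k`-inconsistent. -/
def HasTP (T : L.Theory) {α β : Type} (φ : L.Formula (α ⊕ β)) : Prop :=
  ∃ (M : Theory.ModelType.{0, 0, 0} T) (k : ℕ) (a : List ℕ → β → M), 2 ≤ k ∧
    (∀ η : ℕ → ℕ, FinConsistent φ (fun i : ℕ => a ((List.range i).map η))) ∧
    (∀ s : List ℕ, KInconsistent k φ (fun i : ℕ => a (s ++ [i])))

/-- `T` is simple: no formula (in finite tuples of variables) has the tree property. -/
def IsSimple (T : L.Theory) : Prop :=
  ∀ (p q : ℕ) (φ : L.Formula (Fin p ⊕ Fin q)), ¬ HasTP T φ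

/-- `φ(x; y)` has SOP₁ in `T`: there are a model of `T` and a tree of parameters indexed by
`2^{<ω}` such that along each branch the instances of `φ` are consistent, and whenever `ν`
extends `η⌢0`, the formulas `φ(x; a_ν)` and `φ(x; a_{η⌢1})` have no common solution. -/
def HasSOP1 (T : L.Theory) {α β : Type} (φ : L.Formula (α ⊕ β)) : Prop :=
  ∃ (M : Theory.ModelType.{0, 0, 0} T) (a : List Bool → β → M),
    (∀ η : ℕ → Bool, FinConsistent φ (fun i : ℕ => a ((List.range i).map η))) ∧
    (∀ η ν : List Bool, (η ++ [false]) <+: ν →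
      ¬ ∃ x : α → M, φ.Realize (Sum.elim x (a ν)) ∧
        φ.Realize (Sum.elim x (a (η ++ [true]))))

/-- `T` is NSOP₁: no formula (in finite tuples of variables) has SOP₁. -/
def IsNSOP1 (T : L.Theory) : Prop :=
  ∀ (p q : ℕ) (φ : L.Formula (Fin p ⊕ Fin q)), ¬ HasSOP1 T φ

/-- `T` is properly NSOP₁: it is NSOP₁ but not simple. -/
def IsProperlyNSOP1 (T : L.Theory) : Prop :=
  IsNSOP1 T ∧ ¬ IsSimple T

/-- `φ(x; y)` has TP₂ in `T`: there are a model of `T`, an array of parameters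
`(a i j)_{i, j < ω}` and some `k ≥ 2` such that each row is `k`-inconsistent, and each path
choosing one entry in every row is consistent. -/
def HasTP2 (T : L.Theory) {α β : Type} (φ : L.Formula (α ⊕ β)) : Prop :=
  ∃ (M : Theory.ModelType.{0, 0, 0} T) (k : ℕ) (a : ℕ → ℕ → β → M), 2 ≤ k ∧
    (∀ i : ℕ, KInconsistent k φ (a i)) ∧
    (∀ σ : ℕ → ℕ, FinConsistent φ (fun i : ℕ => a i (σ i)))

end Classification

/-! ### Incidence structures -/

namespace Incidence

/-- Relation symbols: unary `P` (points), unary `L` (lines), binary `I` (incidence). -/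
inductive Rel : ℕ → Type
  | P : Rel 1
  | L : Rel 1
  | I : Rel 2

/-- The language `{P, L, I}` of incidence structures. -/
def lang : FirstOrder.Language.{0, 0} := ⟨fun _ => Empty, Rel⟩

/-- The symbol for "is a point". -/
abbrev symP : lang.Relations 1 := Rel.P

/-- The symbol for "is a line". -/
abbrev symL : lang.Relations 1 := Rel.L

/-- The symbol for incidence. -/
abbrev symI : lang.Relations 2 := Rel.I

section Formulas

variable {α ι κ : Type}

/-- The atomic formula `P(u)`. -/
def isPt (u : α) : lang.Formula α := symP.formula₁ (Term.var u)

/-- The atomic formula `L(u)`. -/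
def isLn (u : α) : lang.Formula α := symL.formula₁ (Term.var u)

/-- The atomic formula `I(u, v)`. -/
def inc (u v : α) : lang.Formula α := symI.formula₂ (Term.var u) (Term.var v)

/-- The atomic formula `u = v`. -/
def eqv (u v : α) : lang.Formula α := Term.equal (Term.var u) (Term.var v)

/-- The variables `x i` take pairwise distinct values. -/
def distinct [Finite ι] (x : ι → α) : lang.Formula α :=
  Formula.iInf fun p : {p : ι × ι // p.1 ≠ p.2} => (eqv (x p.1.1) (x p.1.2)).not

/-- All the `x i` are points. -/
def allPt [Finite ι] (x : ι → α) : lang.Formula α := Formula.iInf fun i => isPt (x i)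

/-- All the `y j` are lines. -/
def allLn [Finite κ] (y : κ → α) : lang.Formula α := Formula.iInf fun j => isLn (y j)

/-- Every `x i` is incident to every `y j`. -/
def allInc [Finite ι] [Finite κ] (x : ι → α) (y : κ → α) : lang.Formula α :=
  Formula.iInf fun p : ι × κ => inc (x p.1) (y p.2)

/-- The sentence obtained by universally quantifying all variables. -/
def forallAll [Finite α] (φ : lang.Formula α) : lang.Sentence :=
  Formula.iAlls α (φ.relabel Sum.inr)

end Formulas

/-- Every element is a point or a line. -/
def axCover : lang.Sentence := forallAll (α := Unit) (isPt () ⊔ isLn ())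

/-- No element is both a point and a line. -/
def axDisjoint : lang.Sentence := forallAll (α := Unit) (isPt () ⊓ isLn ()).not

/-- Incidence holds only between a point and a line, in this order. -/
def axIncidence : lang.Sentence :=
  forallAll (α := Fin 2) ((inc 0 1).imp (isPt 0 ⊓ isLn 1))

/-- There are no `m` distinct points and `n` distinct lines such that each of these points is
incident to each of these lines. -/
def axFree (m n : ℕ) : lang.Sentence :=
  forallAll (α := Fin m ⊕ Fin n)
    ((distinct (Sum.inl : Fin m → Fin m ⊕ Fin n) ⊓ allPt (Sum.inl : Fin m → Fin m ⊕ Fin n) ⊓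
      (distinct (Sum.inr : Fin n → Fin m ⊕ Fin n) ⊓ allLn (Sum.inr : Fin n → Fin m ⊕ Fin n)) ⊓
      allInc Sum.inl Sum.inr).not)

/-- The theory `T^p_{m,n}` of `K_{m,n}`-free incidence structures. -/
def Tp (m n : ℕ) : lang.Theory := {axCover, axDisjoint, axIncidence, axFree m n}

/-- Any `m` distinct points simultaneously lie on exactly `r` lines: there are distinct lines
`y_1, …, y_r` incident to all of them, and every line incident to all of them is some `y_j`. -/
def axLines (m r : ℕ) : lang.Sentence :=
  forallAll (α := Fin m) <| (distinct id ⊓ allPt id).imp <|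
    Formula.iExs (Fin r) <|
      (distinct (Sum.inr : Fin r → Fin m ⊕ Fin r) ⊓ allLn Sum.inr ⊓ allInc Sum.inl Sum.inr) ⊓
      Formula.iAlls Unit
        ((isLn (Sum.inr ()) ⊓
            allInc (fun i : Fin m => Sum.inl (Sum.inl i)) (fun u : Unit => Sum.inr u)).imp
          (Formula.iSup fun j : Fin r =>
            eqv (Sum.inr () : (Fin m ⊕ Fin r) ⊕ Unit) (Sum.inl (Sum.inr j))))

/-- Any `n` distinct lines intersect in exactly `r` points: there are distinct points
`x_1, …, x_r` incident to all of them, and every point incident to all of them is some `x_i`. -/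
def axPoints (n r : ℕ) : lang.Sentence :=
  forallAll (α := Fin n) <| (distinct id ⊓ allLn id).imp <|
    Formula.iExs (Fin r) <|
      (distinct (Sum.inr : Fin r → Fin n ⊕ Fin r) ⊓ allPt Sum.inr ⊓ allInc Sum.inr Sum.inl) ⊓
      Formula.iAlls Unit
        ((isPt (Sum.inr ()) ⊓
            allInc (fun u : Unit => Sum.inr u) (fun j : Fin n => Sum.inl (Sum.inl j))).imp
          (Formula.iSup fun i : Fin r =>
            eqv (Sum.inr () : (Fin n ⊕ Fin r) ⊕ Unit) (Sum.inl (Sum.inr i))))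

/-- The theory `T^c_{m,n}` of `K_{m,n}`-free incidence structures in which any `m` points lie on
exactly `n - 1` lines and any `n` lines intersect in exactly `m - 1` points. -/
def Tc (m n : ℕ) : lang.Theory := Tp m n ∪ {axLines m (n - 1), axPoints n (m - 1)}

/-- A structure for the language `{P, L, I}` given by its points, lines and incidences. -/
@[reducible] def mkStructure {A : Type} (P L : A → Prop) (I : A → A → Prop) :
    lang.Structure A where
  funMap := fun f => Empty.elim f
  RelMap := fun {_} r v =>
    match r, v with
    | Rel.P, v => P (v 0)
    | Rel.L, v => L (v 0)
    | Rel.I, v => I (v 0) (v 1)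

open Classical in
/-- The formula `ψ` if `p` is true and its negation if `p` is false. -/
def literal {α : Type} (p : Prop) (ψ : lang.Formula α) : lang.Formula α :=
  if p then ψ else ψ.not

/-- The diagram of a finite structure on the set `A`, each element of `A` being used as the
variable that labels it: the conjunction of all atomic and negated atomic formulas that hold. -/
def diag {A : Type} [Finite A] (S : lang.Structure A) : lang.Formula A :=
  (Formula.iInf fun p : A × A => literal (p.1 = p.2) (eqv p.1 p.2)) ⊓
  (Formula.iInf fun u : A => literal (S.RelMap symP ![u]) (isPt u)) ⊓
  (Formula.iInf fun u : A => literal (S.RelMap symL ![u]) (isLn u)) ⊓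
  (Formula.iInf fun p : A × A => literal (S.RelMap symI ![p.1, p.2]) (inc p.1 p.2))

/-- The structure induced on the labels of the variables `x`. -/
@[reducible] def restrictLeft {X Y : Type} (S : lang.Structure (X ⊕ Y)) : lang.Structure X :=
  mkStructure (fun u => S.RelMap symP ![Sum.inl u]) (fun u => S.RelMap symL ![Sum.inl u])
    (fun u v => S.RelMap symI ![Sum.inl u, Sum.inl v])

/-- The diagram `Δ(x; y)` of a structure `S`, whose elements are labelled by the variables
`x_1, …, x_k` and `y_1, …, y_l`, is safe: `S` is a model of `T^p_{m,n}`, every `y_i` which is a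
point is incident to at most `n - 1` of the lines `x_j`, and every `y_i` which is a line is
incident to at most `m - 1` of the points `x_j`. -/
def IsSafe (m n : ℕ) {k l : ℕ} (S : lang.Structure (Fin k ⊕ Fin l)) : Prop :=
  @Theory.Model lang (Fin k ⊕ Fin l) S (Tp m n) ∧
  (∀ i : Fin l, S.RelMap symP ![Sum.inr i] →
    {j : Fin k | S.RelMap symL ![Sum.inl j] ∧
      S.RelMap symI ![Sum.inr i, Sum.inl j]}.ncard ≤ n - 1) ∧
  (∀ i : Fin l, S.RelMap symL ![Sum.inr i] →
    {j : Fin k | S.RelMap symP ![Sum.inl j] ∧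
      S.RelMap symI ![Sum.inl j, Sum.inr i]}.ncard ≤ m - 1)

/-- The axiom `∀ x, (Δ^(x) → ∃ y, Δ(x; y))`, where `Δ(x; y)` is the diagram of `S` and `Δ^(x)`
is the part of it that mentions only variables among `x`. -/
def axExtension {k l : ℕ} (S : lang.Structure (Fin k ⊕ Fin l)) : lang.Sentence :=
  forallAll (α := Fin k) ((diag (restrictLeft S)).imp (Formula.iExs (Fin l) (diag S)))

/-- The theory `T_{m,n}` of existentially closed `K_{m,n}`-free incidence structures. -/
def Tmn (m n : ℕ) : lang.Theory :=
  Tc m n ∪ {θ | ∃ (k l : ℕ) (S : lang.Structure (Fin k ⊕ Fin l)),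
    IsSafe m n S ∧ θ = axExtension S}

/-! ### The configuration `Γ` and the formula `φ` -/

/-- The domain of `Γ`: the elements `a_1, a_2`, then `b, c_1, …, c_{n-1}`, then
`w_1, …, w_{m-1}`, and then `z`. -/
abbrev GammaDom (m n : ℕ) : Type := (Fin 2 ⊕ Fin n) ⊕ (Fin (m - 1) ⊕ Unit)

/-- The points of `Γ`: `a_1`, `b` and the `w_i`. -/
def gammaP (m n : ℕ) : GammaDom m n → Prop
  | Sum.inl (Sum.inl i) => i = 0
  | Sum.inl (Sum.inr j) => j.val = 0
  | Sum.inr (Sum.inl _) => True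
  | Sum.inr (Sum.inr _) => False

/-- The incidences of `Γ`: `(a_1, z)`, `(b, z)`, and `(w_i, a_2)`, `(w_i, c_j)`, `(w_i, z)` for
all `i` and `j`. -/
def gammaI (m n : ℕ) : GammaDom m n → GammaDom m n → Prop
  | Sum.inl (Sum.inl i), Sum.inr (Sum.inr _) => i = 0
  | Sum.inl (Sum.inr j), Sum.inr (Sum.inr _) => j.val = 0
  | Sum.inr (Sum.inl _), Sum.inl (Sum.inl i) => i = 1
  | Sum.inr (Sum.inl _), Sum.inl (Sum.inr j) => j.val ≠ 0
  | Sum.inr (Sum.inl _), Sum.inr (Sum.inr _) => True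
  | _, _ => False

/-- The incidence structure `Γ`. The elements that are not points (namely `a_2`, the `c_j` and
`z`) are lines. -/
@[reducible] def gamma (m n : ℕ) : lang.Structure (GammaDom m n) :=
  mkStructure (gammaP m n) (fun u => ¬ gammaP m n u) (gammaI m n)

/-- The formula `φ(x_1, x_2; y_1, …, y_n)`: there are `w_1, …, w_{m-1}` and `z` such that
`(a_1, a_2, b, c_1, …, c_{n-1}, w_1, …, w_{m-1}, z) ↦ (x_1, x_2, y_1, …, y_n, w_1, …, w_{m-1}, z)`
is an isomorphism from `Γ` to the incidence structure induced on these elements. -/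
def phi (m n : ℕ) : lang.Formula (Fin 2 ⊕ Fin n) :=
  Formula.iExs (Fin (m - 1) ⊕ Unit) (diag (gamma m n))

end Incidence

end

open FirstOrder FirstOrder.Language

noncomputable section

/-! Points and lines play dual roles, so structures are treated as two-coloured graphs: `col` is the
colour, `Adj` the undirected incidence, and `sz` gives the critical size (`m` or `n`) of each
colour.

The basic fact is `IsComplete.closed`. If a complete `A` lies in a free `B`, then an element of `B`
with critically many neighbours in `A` belongs to `A`, because `A` already contains all the common
neighbours that freeness permits. Free structures can therefore be glued along a complete one
without adding incidences, and more generally along any family in which the new elements of one side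
have few neighbours (`exists_freeAmalgam_family`). Repeatedly adding missing common neighbours and
realizing safe extensions puts every free structure inside a model (`exists_model`). Closedness also
makes finite extensions of a model inside free structures safe, so models are existentially closed
and embeddings between them are elementary (`realize_map`).

For TP₂, the free structure `Config` contains an array of instances of `phi` together with a
solution for every path. In a row, all instances share the lines `c`; freeness first forces a common
block `w`, then leaves at most `n - 1` candidates for `z`, and the lines `ell` prevent any such line
from serving more than `m` columns. TP₂ gives the tree property, hence non-simplicity.

For NSOP₁, an SOP₁ tree in a countable model `M` yields a consistent sequence `c₀` and a pairwise
inconsistent sequence `c₁` whose limits `b₀`, `b₁` along an ultrafilter have the same type over `M`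
(`IsSOP1Tree.exists_sequences`). A solution `a` of all instances at `c₀` satisfies `φ(a; b₀)` with
`a` and `b₀` in copies of an ultrapower that are independent over `M`. The type equality replaces
`b₀` by `b₁` (`Indep.exists_transfer`), and independent amalgamation gives one solution for two
independent copies of `b₁` (`Indep.exists_amalgam`). Unwinding the ultrapowers gives a common
solution for two members of `c₁`, a contradiction (`not_exists_sequences`). -/

namespace Incidence

/-! ### Quantifier-free types through colour and adjacency -/

section Basic

variable {A B C X Y : Type} [lang.Structure A] [lang.Structure B] [lang.Structure C]

/-- `x` is a point. -/
def Pt (x : A) : Prop := Structure.RelMap symP ![x]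

/-- `x` is a line. -/
def Ln (x : A) : Prop := Structure.RelMap symL ![x]

/-- `x` is incident to `y`. -/
def Ic (x y : A) : Prop := Structure.RelMap symI ![x, y]

/-- The symmetric closure of incidence. -/
def Adj (x y : A) : Prop := Ic x y ∨ Ic y x

open Classical in
/-- The colour of an element: `true` for points and `false` for the other elements. -/
def col (x : A) : Bool := decide (Pt x)

theorem col_eq_true {x : A} : col x = true ↔ Pt x := by simp [col]

theorem Ic.adj {x y : A} (h : Ic x y) : Adj x y := Or.inl h

theorem Ic.adj' {x y : A} (h : Ic x y) : Adj y x := Or.inr h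

theorem Adj.symm {x y : A} (h : Adj x y) : Adj y x := Or.symm h

theorem adj_comm {x y : A} : Adj x y ↔ Adj y x := ⟨Adj.symm, Adj.symm⟩

variable (A) in
/-- Points and lines partition the domain, and incidence relates points to lines. -/
structure IsInc : Prop where
  cover : ∀ x : A, Pt x ∨ Ln x
  disjoint : ∀ x : A, ¬ (Pt x ∧ Ln x)
  incidence : ∀ x y : A, Ic x y → Pt x ∧ Ln y

theorem IsInc.ln_iff (h : IsInc A) (x : A) : Ln x ↔ ¬ Pt x := by
  have := h.cover x; have := h.disjoint x; tauto

theorem IsInc.ln_iff_col (h : IsInc A) (x : A) : Ln x ↔ col x = false := by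
  rw [h.ln_iff, ← col_eq_true]; simp

theorem IsInc.col_ne (h : IsInc A) {x y : A} (hxy : Adj x y) : col y = !col x := by
  rcases hxy with hxy | hxy
  · have := h.incidence _ _ hxy
    rw [h.ln_iff_col, ← col_eq_true] at this; simp [this.1, this.2]
  · have := h.incidence _ _ hxy
    rw [h.ln_iff_col, ← col_eq_true] at this; simp [this.1, this.2]

theorem IsInc.ic_iff (h : IsInc A) (x y : A) : Ic x y ↔ col x = true ∧ Adj x y := by
  refine ⟨fun hi => ⟨col_eq_true.2 (h.incidence _ _ hi).1, Or.inl hi⟩, ?_⟩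
  rintro ⟨hc, hi | hi⟩
  · exact hi
  · have := (h.incidence _ _ hi).2
    rw [h.ln_iff_col, hc] at this; simp at this

/-- Two labelled families have the same quantifier-free type. -/
structure SameType (f : X → A) (g : X → B) : Prop where
  eq_iff : ∀ x y, f x = f y ↔ g x = g y
  pt_iff : ∀ x, Pt (f x) ↔ Pt (g x)
  ln_iff : ∀ x, Ln (f x) ↔ Ln (g x)
  ic_iff : ∀ x y, Ic (f x) (f y) ↔ Ic (g x) (g y)

/-- The colour decides whether an element is a point or a line and which way an edge is oriented, so
undirected data determine the quantifier-free type. -/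
theorem SameType.of_col_adj (hA : IsInc A) (hB : IsInc B) {f : X → A} {g : X → B}
    (he : ∀ x y, f x = f y ↔ g x = g y) (hc : ∀ x, col (f x) = col (g x))
    (ha : ∀ x y, Adj (f x) (f y) ↔ Adj (g x) (g y)) : SameType f g where
  eq_iff := he
  pt_iff x := by rw [← col_eq_true, ← col_eq_true, hc]
  ln_iff x := by rw [hA.ln_iff_col, hB.ln_iff_col, hc]
  ic_iff x y := by rw [hA.ic_iff, hB.ic_iff, hc, ha]

theorem SameType.col_eq {f : X → A} {g : X → B} (h : SameType f g) (x : X) :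
    col (f x) = col (g x) := by
  rw [Bool.eq_iff_iff, col_eq_true, col_eq_true, h.pt_iff]

theorem SameType.adj_iff {f : X → A} {g : X → B} (h : SameType f g) (x y : X) :
    Adj (f x) (f y) ↔ Adj (g x) (g y) := by
  rw [Adj, Adj, h.ic_iff, h.ic_iff]

theorem SameType.symm {f : X → A} {g : X → B} (h : SameType f g) : SameType g f where
  eq_iff x y := (h.eq_iff x y).symm
  pt_iff x := (h.pt_iff x).symm
  ln_iff x := (h.ln_iff x).symm
  ic_iff x y := (h.ic_iff x y).symm

theorem SameType.trans {f : X → A} {g : X → B} {k : X → C} (h : SameType f g)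
    (h' : SameType g k) : SameType f k where
  eq_iff x y := (h.eq_iff x y).trans (h'.eq_iff x y)
  pt_iff x := (h.pt_iff x).trans (h'.pt_iff x)
  ln_iff x := (h.ln_iff x).trans (h'.ln_iff x)
  ic_iff x y := (h.ic_iff x y).trans (h'.ic_iff x y)

theorem SameType.comp {f : X → A} {g : X → B} (h : SameType f g) (k : Y → X) :
    SameType (f ∘ k) (g ∘ k) where
  eq_iff x y := h.eq_iff (k x) (k y)
  pt_iff x := h.pt_iff (k x)
  ln_iff x := h.ln_iff (k x)
  ic_iff x y := h.ic_iff (k x) (k y)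

theorem pt_map (e : A ↪[lang] B) (x : A) : Pt (e x) ↔ Pt x := by
  rw [Pt, Pt, ← e.map_rel symP ![x], show e ∘ ![x] = ![e x] from List.ofFn_inj.mp rfl]

theorem ln_map (e : A ↪[lang] B) (x : A) : Ln (e x) ↔ Ln x := by
  rw [Ln, Ln, ← e.map_rel symL ![x], show e ∘ ![x] = ![e x] from List.ofFn_inj.mp rfl]

theorem ic_map (e : A ↪[lang] B) (x y : A) : Ic (e x) (e y) ↔ Ic x y := by
  rw [Ic, Ic, ← e.map_rel symI ![x, y], show e ∘ ![x, y] = ![e x, e y] from List.ofFn_inj.mp rfl]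

theorem adj_map (e : A ↪[lang] B) (x y : A) : Adj (e x) (e y) ↔ Adj x y := by
  rw [Adj, Adj, ic_map, ic_map]

theorem col_map (e : A ↪[lang] B) (x : A) : col (e x) = col x := by
  rw [Bool.eq_iff_iff, col_eq_true, col_eq_true, pt_map]

theorem sameType_map (e : A ↪[lang] B) (f : X → A) : SameType f (fun x => e (f x)) where
  eq_iff _ _ := e.injective.eq_iff.symm
  pt_iff _ := (pt_map e _).symm
  ln_iff _ := (ln_map e _).symm
  ic_iff _ _ := (ic_map e _ _).symm

/-- A map preserving quantifier-free types is an embedding. -/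
def SameType.toEmbedding {e : A → B} (h : SameType (id : A → A) e) : A ↪[lang] B where
  toFun := e
  inj' x y hxy := (h.eq_iff x y).2 hxy
  map_fun' := fun f => Empty.elim f
  map_rel' := by
    rintro n (_ | _ | _) v
    · have h1 : v = ![v 0] := List.ofFn_inj.mp rfl
      have h2 : e ∘ v = ![e (v 0)] := List.ofFn_inj.mp rfl
      rw [h2, h1]; exact (h.pt_iff (v 0)).symm
    · have h1 : v = ![v 0] := List.ofFn_inj.mp rfl
      have h2 : e ∘ v = ![e (v 0)] := List.ofFn_inj.mp rfl
      rw [h2, h1]; exact (h.ln_iff (v 0)).symm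
    · have h1 : v = ![v 0, v 1] := List.ofFn_inj.mp rfl
      have h2 : e ∘ v = ![e (v 0), e (v 1)] := List.ofFn_inj.mp rfl
      rw [h2, h1]; exact (h.ic_iff (v 0) (v 1)).symm

end Basic

/-! ### Structures given by a colouring and an adjacency relation -/

/-- The structure with given colour classes, incidence being adjacency. -/
@[reducible] def bip {A : Type} (c : A → Bool) (r : A → A → Prop) : lang.Structure A :=
  mkStructure (fun x => c x = true) (fun x => c x = false)
    (fun x y => c x = true ∧ c y = false ∧ r x y)

theorem isInc_bip {A : Type} (c : A → Bool) (r : A → A → Prop) : @IsInc A (bip c r) := by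
  let _ := bip c r
  refine ⟨fun x => ?_, fun x => ?_, fun x y h => ⟨h.1, h.2.1⟩⟩
  · change c x = true ∨ c x = false
    cases c x <;> simp
  · change ¬ (c x = true ∧ c x = false)
    cases c x <;> simp

theorem col_bip {A : Type} (c : A → Bool) (r : A → A → Prop) (x : A) :
    @col A (bip c r) x = c x := by
  let _ := bip c r
  rw [Bool.eq_iff_iff, col_eq_true]; rfl

/-- `bip` keeps an edge only from its `true` end to its `false` end. Symmetry and alternation of
colours ensure that no edge is lost. -/
theorem adj_bip {A : Type} {c : A → Bool} {r : A → A → Prop}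
    (hs : ∀ x y, r x y → r y x) (hc : ∀ x y, r x y → c y = !c x) (x y : A) :
    @Adj A (bip c r) x y ↔ r x y := by
  let _ := bip c r
  constructor
  · rintro (h | h)
    exacts [h.2.2, hs _ _ h.2.2]
  · intro h
    have h' := hc _ _ h
    cases hx : c x
    · exact Or.inr ⟨by simpa [hx] using h', hx, hs _ _ h⟩
    · exact Or.inl ⟨hx, by simpa [hx] using h', h⟩

/-! ### Freeness and completeness -/

/-- The number of elements of a given colour in a forbidden configuration. -/
def sz (m n : ℕ) (c : Bool) : ℕ := cond c m n

variable (m n : ℕ)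

/-- A `K_{m,n}`-free incidence structure. -/
structure KFree (A : Type) [lang.Structure A] : Prop extends IsInc A where
  free : ∀ c (S T : Finset A), (∀ x ∈ S, col x = c) → (∀ y ∈ T, col y = !c) →
    (∀ x ∈ S, ∀ y ∈ T, Adj x y) → sz m n c ≤ S.card → ¬ sz m n (!c) ≤ T.card

/-- Any `m` points lie on `n - 1` lines and dually. -/
def IsComplete (A : Type) [lang.Structure A] : Prop :=
  ∀ c (S : Finset A), (∀ x ∈ S, col x = c) → S.card = sz m n c →
    ∃ T : Finset A, (∀ y ∈ T, col y = !c) ∧ (∀ x ∈ S, ∀ y ∈ T, Adj x y) ∧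
      T.card = sz m n (!c) - 1

variable {m n}
variable {A B : Type} [lang.Structure A] [lang.Structure B]

/-- The condition for the colour `false` is the one for `true` with the two sets exchanged. -/
theorem KFree.mk' (hA : IsInc A) (h : ∀ S T : Finset A, (∀ x ∈ S, col x = true) →
    (∀ y ∈ T, col y = false) → (∀ x ∈ S, ∀ y ∈ T, Adj x y) → m ≤ S.card → n ≤ T.card → False) :
    KFree m n A where
  toIsInc := hA
  free c S T hS hT hST h1 h2 := by
    cases c
    · exact h T S (by simpa using hT) (by simpa using hS) (fun x hx y hy => (hST y hy x hx).symm)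
        h2 h1
    · exact h S T hS (by simpa using hT) hST h1 h2

/-- Finsets inside the range of a map are images. -/
theorem exists_finset_image {X Y : Type} [DecidableEq Y] (f : X → Y) (hf : Function.Injective f)
    (S : Finset Y) (h : ∀ y ∈ S, y ∈ Set.range f) :
    ∃ S' : Finset X, S'.image f = S ∧ S'.card = S.card := by
  obtain ⟨S', hS'⟩ := Finset.subset_set_image_iff.1
    (show (S : Set Y) ⊆ f '' Set.univ by intro y hy; simpa using h y hy)
  exact ⟨S', hS'.2, by rw [← hS'.2, Finset.card_image_of_injective _ hf]⟩

open Classical in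
/-- A configuration inside the image of a free structure is impossible. -/
theorem KFree.not_image (hA : KFree m n A) (e : A ↪[lang] B) {c : Bool} {S T : Finset B}
    (hS : ∀ x ∈ S, col x = c) (hT : ∀ y ∈ T, col y = !c) (h : ∀ x ∈ S, ∀ y ∈ T, Adj x y)
    (h1 : sz m n c ≤ S.card) (h2 : sz m n (!c) ≤ T.card)
    (hS' : ∀ x ∈ S, x ∈ Set.range e) (hT' : ∀ x ∈ T, x ∈ Set.range e) : False := by
  obtain ⟨S', rfl, hc⟩ := exists_finset_image e e.injective S hS'
  obtain ⟨T', rfl, hc'⟩ := exists_finset_image e e.injective T hT'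
  simp only [Finset.forall_mem_image, col_map, adj_map] at hS hT h
  exact hA.free c S' T' hS hT h (hc ▸ h1) (hc' ▸ h2)

theorem KFree.of_embedding (hB : KFree m n B) (hA : IsInc A) (e : A ↪[lang] B) : KFree m n A := by
  classical
  refine ⟨hA, fun c S T hS hT h h1 h2 => hB.free c (S.image e) (T.image e) ?_ ?_ ?_ ?_ ?_⟩
  · simpa only [Finset.forall_mem_image, col_map] using hS
  · simpa only [Finset.forall_mem_image, col_map] using hT
  · simpa only [Finset.forall_mem_image, adj_map] using h
  · rwa [Finset.card_image_of_injective _ e.injective]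
  · rwa [Finset.card_image_of_injective _ e.injective]

theorem IsInc.of_embedding (hB : IsInc B) (e : A ↪[lang] B) : IsInc A where
  cover x := by rw [← pt_map e, ← ln_map e]; exact hB.cover _
  disjoint x := by rw [← pt_map e, ← ln_map e]; exact hB.disjoint _
  incidence x y := by rw [← pt_map e, ← ln_map e, ← ic_map e]; exact hB.incidence _ _

/-- Complete structures are closed in free extensions. -/
theorem IsComplete.closed (hA : IsComplete m n A) (hB : KFree m n B) (hm : 1 ≤ m) (hn : 1 ≤ n)
    (e : A ↪[lang] B) (x : B)
    (S : Finset B) (hS : ∀ y ∈ S, y ∈ Set.range e) (hadj : ∀ y ∈ S, Adj x y)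
    (hcard : sz m n (!col x) ≤ S.card) : x ∈ Set.range e := by
  classical
  by_contra hx
  obtain ⟨S₁, hS₁, hc⟩ := Finset.exists_subset_card_eq hcard
  obtain ⟨S', rfl, hc'⟩ := exists_finset_image e e.injective S₁ (fun y hy => hS y (hS₁ hy))
  have hcol : ∀ y ∈ S', col y = !col x := fun y hy => by
    rw [← col_map e]; exact hB.col_ne (hadj _ (hS₁ (Finset.mem_image_of_mem _ hy)))
  -- Inside `A` the set already has `sz - 1` common neighbours; `x`, if outside the image, would be
  -- one more than freeness of `B` allows.
  obtain ⟨T, hT, hT', hTc⟩ := hA (!col x) S' hcol (hc'.trans hc)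
  rw [Bool.not_not] at hT hTc
  have hnot : x ∉ T.image e := fun h => by
    obtain ⟨y, _, rfl⟩ := Finset.mem_image.1 h
    exact hx ⟨y, rfl⟩
  have hpos : 1 ≤ sz m n (col x) := by cases col x <;> assumption
  refine hB.free (!col x) (S'.image e) (insert x (T.image e)) ?_ ?_ ?_ hc.ge ?_
  · simpa only [Finset.forall_mem_image, col_map] using hcol
  · simp only [Finset.mem_insert, forall_eq_or_imp, Finset.forall_mem_image, col_map, Bool.not_not]
    exact ⟨trivial, hT⟩
  · simp only [Finset.mem_insert, forall_eq_or_imp, Finset.forall_mem_image, adj_map]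
    exact fun y hy => ⟨(hadj _ (hS₁ (Finset.mem_image_of_mem _ hy))).symm, hT' y hy⟩
  · rw [Finset.card_insert_of_notMem hnot, Finset.card_image_of_injective _ e.injective, hTc,
      Bool.not_not]
    omega

end Incidence

namespace Incidence

/-! ### Semantics of the axioms -/

section Realize

variable {M : Type} [lang.Structure M] {α ι κ : Type}

@[simp] theorem realize_isPt (u : α) (v : α → M) : (isPt u).Realize v ↔ Pt (v u) :=
  Formula.realize_rel₁

@[simp] theorem realize_isLn (u : α) (v : α → M) : (isLn u).Realize v ↔ Ln (v u) :=
  Formula.realize_rel₁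

@[simp] theorem realize_inc (u w : α) (v : α → M) : (inc u w).Realize v ↔ Ic (v u) (v w) :=
  Formula.realize_rel₂

@[simp] theorem realize_eqv (u w : α) (v : α → M) : (eqv u w).Realize v ↔ v u = v w := by
  simp [eqv, Formula.realize_equal]

@[simp] theorem realize_distinct [Finite ι] (x : ι → α) (v : α → M) :
    (distinct x).Realize v ↔ Function.Injective (v ∘ x) := by
  simp only [distinct, Formula.realize_iInf, Formula.realize_not, realize_eqv, Subtype.forall,
    Prod.forall]
  exact forall₂_congr fun a b => not_imp_not

@[simp] theorem realize_allPt [Finite ι] (x : ι → α) (v : α → M) :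
    (allPt x).Realize v ↔ ∀ i, Pt (v (x i)) := by
  simp [allPt]

@[simp] theorem realize_allLn [Finite ι] (x : ι → α) (v : α → M) :
    (allLn x).Realize v ↔ ∀ i, Ln (v (x i)) := by
  simp [allLn]

@[simp] theorem realize_allInc [Finite ι] [Finite κ] (x : ι → α) (y : κ → α) (v : α → M) :
    (allInc x y).Realize v ↔ ∀ i j, Ic (v (x i)) (v (y j)) := by
  simp [allInc]

theorem realize_forallAll [Finite α] (φ : lang.Formula α) :
    M ⊨ forallAll φ ↔ ∀ v : α → M, φ.Realize v := by
  rw [Sentence.Realize, forallAll, Formula.realize_iAlls]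
  simp only [Formula.realize_relabel]
  exact forall_congr' fun v => Iff.rfl

theorem realize_literal {p : Prop} {ψ : lang.Formula α} {v : α → M} :
    (literal p ψ).Realize v ↔ (p ↔ ψ.Realize v) := by
  by_cases h : p <;> simp [literal, h]

theorem realize_diag {A : Type} [Finite A] [S : lang.Structure A] (v : A → M) :
    (diag S).Realize v ↔ SameType (id : A → A) v := by
  simp only [diag, Formula.realize_inf, Formula.realize_iInf, realize_literal, Prod.forall,
    realize_eqv, realize_isPt, realize_isLn, realize_inc]
  exact ⟨fun h => ⟨h.1.1.1, h.1.1.2, h.1.2, h.2⟩, fun h => ⟨⟨⟨h.1, h.2⟩, h.3⟩, h.4⟩⟩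

theorem models_axCover : M ⊨ axCover ↔ ∀ x : M, Pt x ∨ Ln x := by
  simp only [axCover, realize_forallAll, Formula.realize_sup, realize_isPt, realize_isLn]
  exact ⟨fun h x => h fun _ => x, fun h v => h _⟩

theorem models_axDisjoint : M ⊨ axDisjoint ↔ ∀ x : M, ¬ (Pt x ∧ Ln x) := by
  simp only [axDisjoint, realize_forallAll, Formula.realize_not, Formula.realize_inf,
    realize_isPt, realize_isLn]
  exact ⟨fun h x => h fun _ => x, fun h v => h _⟩

theorem models_axIncidence : M ⊨ axIncidence ↔ ∀ x y : M, Ic x y → Pt x ∧ Ln y := by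
  simp only [axIncidence, realize_forallAll, Formula.realize_imp, Formula.realize_inf,
    realize_isPt, realize_isLn, realize_inc]
  exact ⟨fun h x y => h ![x, y], fun h v => h _ _⟩

theorem models_axFree (m n : ℕ) : M ⊨ axFree m n ↔ ∀ (p : Fin m → M) (l : Fin n → M),
    Function.Injective p → Function.Injective l → (∀ i, Pt (p i)) → (∀ j, Ln (l j)) →
      ¬ ∀ i j, Ic (p i) (l j) := by
  simp only [axFree, realize_forallAll, Formula.realize_not, Formula.realize_inf,
    realize_distinct, realize_allPt, realize_allLn, realize_allInc]
  refine ⟨fun h p l h1 h2 h3 h4 h5 => h (Sum.elim p l) ⟨⟨⟨h1, h3⟩, h2, h4⟩, h5⟩, ?_⟩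
  rintro h v ⟨⟨⟨h1, h3⟩, h2, h4⟩, h5⟩
  exact h _ _ h1 h2 h3 h4 h5

theorem models_axLines (m r : ℕ) : M ⊨ axLines m r ↔ ∀ p : Fin m → M,
    Function.Injective p → (∀ i, Pt (p i)) → ∃ l : Fin r → M, Function.Injective l ∧
      (∀ j, Ln (l j)) ∧ (∀ i j, Ic (p i) (l j)) ∧
      ∀ y, Ln y → (∀ i, Ic (p i) y) → ∃ j, y = l j := by
  simp only [axLines, realize_forallAll, Formula.realize_imp, Formula.realize_inf,
    realize_distinct, realize_allPt, realize_allLn, realize_allInc, Formula.realize_iExs,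
    Formula.realize_iAlls, realize_isLn, Formula.realize_iSup, realize_eqv, Sum.elim_inl,
    Sum.elim_inr, and_imp, Function.comp_def, id_eq]
  refine forall_congr' fun p => forall₂_congr fun _ _ => exists_congr fun l => ?_
  refine ⟨fun h => ⟨h.1.1.1, h.1.1.2, h.1.2, fun y h1 h2 => h.2 (fun _ => y) h1 fun i _ => h2 i⟩,
    fun h => ⟨⟨⟨h.1, h.2.1⟩, h.2.2.1⟩, fun y h1 h2 => h.2.2.2 _ h1 fun i => h2 i ()⟩⟩

theorem models_axPoints (n r : ℕ) : M ⊨ axPoints n r ↔ ∀ l : Fin n → M,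
    Function.Injective l → (∀ i, Ln (l i)) → ∃ p : Fin r → M, Function.Injective p ∧
      (∀ j, Pt (p j)) ∧ (∀ i j, Ic (p i) (l j)) ∧
      ∀ y, Pt y → (∀ i, Ic y (l i)) → ∃ j, y = p j := by
  simp only [axPoints, realize_forallAll, Formula.realize_imp, Formula.realize_inf,
    realize_distinct, realize_allPt, realize_allLn, realize_allInc, Formula.realize_iExs,
    Formula.realize_iAlls, realize_isPt, Formula.realize_iSup, realize_eqv, Sum.elim_inl,
    Sum.elim_inr, and_imp, Function.comp_def, id_eq]
  refine forall_congr' fun p => forall₂_congr fun _ _ => exists_congr fun l => ?_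
  refine ⟨fun h => ⟨h.1.1.1, h.1.1.2, h.1.2, fun y h1 h2 => h.2 (fun _ => y) h1 fun _ i => h2 i⟩,
    fun h => ⟨⟨⟨h.1, h.2.1⟩, h.2.2.1⟩, fun y h1 h2 => h.2.2.2 _ h1 fun i => h2 () i⟩⟩

end Realize

/-! ### The theories as combinatorial properties of coloured structures -/

section Models

variable {m n : ℕ} {M : Type} [lang.Structure M]

/-- An enumeration of a finite set of prescribed size. -/
theorem exists_enum {X : Type} {r : ℕ} (S : Finset X) (h : S.card = r) :
    ∃ f : Fin r → X, Function.Injective f ∧ ∀ x, x ∈ S ↔ ∃ i, f i = x := by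
  subst h
  refine ⟨fun i => (S.equivFin.symm i : X), fun i j hij => by simpa using Subtype.ext hij, ?_⟩
  intro x
  constructor
  · intro hx; exact ⟨S.equivFin ⟨x, hx⟩, by simp⟩
  · rintro ⟨i, rfl⟩; exact (S.equivFin.symm i).2

theorem models_Tp : M ⊨ Tp m n ↔ KFree m n M := by
  classical
  simp only [Tp, Theory.model_iff, Set.mem_insert_iff, Set.mem_singleton_iff, forall_eq_or_imp,
    forall_eq, models_axCover, models_axDisjoint, models_axIncidence, models_axFree]
  constructor
  · rintro ⟨h1, h2, h3, h4⟩
    have hI : IsInc M := ⟨h1, h2, h3⟩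
    refine KFree.mk' hI fun S T hS hT hST hm hn => ?_
    obtain ⟨S', hS', hSc⟩ := Finset.exists_subset_card_eq hm
    obtain ⟨T', hT', hTc⟩ := Finset.exists_subset_card_eq hn
    obtain ⟨p, hp, hpS⟩ := exists_enum S' hSc
    obtain ⟨l, hl, hlT⟩ := exists_enum T' hTc
    have hp' : ∀ i, p i ∈ S := fun i => hS' ((hpS _).2 ⟨i, rfl⟩)
    have hl' : ∀ i, l i ∈ T := fun i => hT' ((hlT _).2 ⟨i, rfl⟩)
    exact h4 p l hp hl (fun i => col_eq_true.1 (hS _ (hp' i)))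
      (fun j => (hI.ln_iff_col _).2 (hT _ (hl' j)))
      fun i j => (hI.ic_iff _ _).2 ⟨hS _ (hp' i), hST _ (hp' i) _ (hl' j)⟩
  · intro h
    refine ⟨h.cover, h.disjoint, h.incidence, fun p l hp hl h1 h2 h3 => ?_⟩
    refine h.free true (Finset.univ.image p) (Finset.univ.image l) ?_ ?_ ?_ ?_ ?_
    · simpa [col_eq_true] using h1
    · simpa [h.ln_iff_col] using h2
    · simpa using fun i j => (h3 i j).adj
    · simp [Finset.card_image_of_injective _ hp, sz]
    · simp [Finset.card_image_of_injective _ hl, sz]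

theorem isComplete_of_models (h : M ⊨ Tc m n) : KFree m n M ∧ IsComplete m n M := by
  classical
  simp only [Tc, Theory.model_union_iff, models_Tp] at h
  obtain ⟨hK, h⟩ := h
  refine ⟨hK, ?_⟩
  simp only [Theory.model_iff, Set.mem_insert_iff, Set.mem_singleton_iff, forall_eq_or_imp,
    forall_eq, models_axLines, models_axPoints] at h
  obtain ⟨h1, h2⟩ := h
  rintro (_ | _) S hS hc
  · obtain ⟨l, hl, hlS⟩ := exists_enum S hc
    obtain ⟨p, hp, hp1, hp2, -⟩ := h2 l hl
      fun i => (hK.ln_iff_col _).2 (hS _ ((hlS _).2 ⟨i, rfl⟩))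
    refine ⟨Finset.univ.image p, ?_, ?_, ?_⟩
    · simpa [col_eq_true] using hp1
    · intro x hx
      obtain ⟨i, rfl⟩ := (hlS _).1 hx
      simpa using fun j => (hp2 j i).adj'
    · simp [Finset.card_image_of_injective _ hp, sz]
  · obtain ⟨p, hp, hpS⟩ := exists_enum S hc
    obtain ⟨l, hl, hl1, hl2, -⟩ := h1 p hp
      fun i => col_eq_true.1 (hS _ ((hpS _).2 ⟨i, rfl⟩))
    refine ⟨Finset.univ.image l, ?_, ?_, ?_⟩
    · simpa [hK.ln_iff_col] using hl1
    · intro x hx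
      obtain ⟨i, rfl⟩ := (hpS _).1 hx
      simpa using fun j => (hl2 i j).adj
    · simp [Finset.card_image_of_injective _ hl, sz]

/-- In a free structure, a maximal family of common neighbours consists of all of them. -/
theorem KFree.mem_of_adj (hK : KFree m n M) {c : Bool} {S T : Finset M}
    (hS : ∀ x ∈ S, col x = c) (hT : ∀ y ∈ T, col y = !c) (hST : ∀ x ∈ S, ∀ y ∈ T, Adj x y)
    (h1 : sz m n c ≤ S.card) (h2 : sz m n (!c) - 1 ≤ T.card) {y : M} (hy : col y = !c)
    (h : ∀ x ∈ S, Adj x y) : y ∈ T := by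
  classical
  by_contra hyT
  refine hK.free c S (insert y T) hS ?_ ?_ h1 ?_
  · simpa [hy] using hT
  · simpa using fun x hx => ⟨h x hx, hST x hx⟩
  · rw [Finset.card_insert_of_notMem hyT]; omega

/-- `IsComplete` only asks for enough common neighbours; that there are no others, as the axioms
require, follows from freeness through `KFree.mem_of_adj`. -/
theorem models_Tc (hK : KFree m n M) (hC : IsComplete m n M) : M ⊨ Tc m n := by
  classical
  simp only [Tc, Theory.model_union_iff, models_Tp]
  refine ⟨hK, ?_⟩
  simp only [Theory.model_iff, Set.mem_insert_iff, Set.mem_singleton_iff, forall_eq_or_imp,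
    forall_eq, models_axLines, models_axPoints]
  constructor
  · intro p hp hp1
    have hS : ∀ x ∈ Finset.univ.image p, col x = true := by simpa [col_eq_true] using hp1
    have hc : (Finset.univ.image p).card = sz m n true := by
      simp [Finset.card_image_of_injective _ hp, sz]
    obtain ⟨T, hT, hST, hTc⟩ := hC true _ hS hc
    obtain ⟨l, hl, hlT⟩ := exists_enum T hTc
    have hl' : ∀ j, l j ∈ T := fun j => (hlT _).2 ⟨j, rfl⟩
    refine ⟨l, hl, fun j => (hK.ln_iff_col _).2 (hT _ (hl' j)), fun i j => ?_, fun y hy h => ?_⟩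
    · exact (hK.ic_iff _ _).2 ⟨col_eq_true.2 (hp1 i), hST _ (by simp) _ (hl' j)⟩
    · obtain ⟨j, hj⟩ := (hlT y).1 (hK.mem_of_adj hS hT hST hc.ge hTc.ge
        ((hK.ln_iff_col _).1 hy) (by simpa using fun i => (h i).adj))
      exact ⟨j, hj.symm⟩
  · intro l hl hl1
    have hS : ∀ x ∈ Finset.univ.image l, col x = false := by simpa [hK.ln_iff_col] using hl1
    have hc : (Finset.univ.image l).card = sz m n false := by
      simp [Finset.card_image_of_injective _ hl, sz]
    obtain ⟨T, hT, hST, hTc⟩ := hC false _ hS hc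
    obtain ⟨p, hp, hpT⟩ := exists_enum T hTc
    have hp' : ∀ j, p j ∈ T := fun j => (hpT _).2 ⟨j, rfl⟩
    refine ⟨p, hp, fun j => col_eq_true.1 (hT _ (hp' j)), fun i j => ?_, fun y hy h => ?_⟩
    · exact (hK.ic_iff _ _).2 ⟨hT _ (hp' i), (hST _ (by simp) _ (hp' i)).symm⟩
    · obtain ⟨j, hj⟩ := (hpT y).1 (hK.mem_of_adj hS hT hST hc.ge hTc.ge
        (col_eq_true.2 hy) (by simpa using fun i => (h i).adj'))
      exact ⟨j, hj.symm⟩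

/-- `S` is safe: it is free and elements of the second kind have few neighbours of the first. -/
theorem isSafe_iff {k l : ℕ} [S : lang.Structure (Fin k ⊕ Fin l)] (hm : 1 ≤ m) (hn : 1 ≤ n) :
    IsSafe m n S ↔ KFree m n (Fin k ⊕ Fin l) ∧ ∀ (i : Fin l) (T : Finset (Fin k)),
      (∀ j ∈ T, Adj (Sum.inr i : Fin k ⊕ Fin l) (Sum.inl j)) →
        T.card < sz m n (!col (Sum.inr i : Fin k ⊕ Fin l)) := by
  classical
  rw [IsSafe, models_Tp]
  refine and_congr_right fun hK => ?_
  constructor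
  · rintro ⟨h1, h2⟩ i T hT
    cases hc : col (Sum.inr i : Fin k ⊕ Fin l)
    · have := h2 i ((hK.ln_iff_col _).2 hc)
      refine lt_of_le_of_lt ?_ (show m - 1 < _ from Nat.sub_lt hm one_pos)
      refine le_trans ?_ this
      rw [← Set.ncard_coe_finset]
      refine Set.ncard_le_ncard (fun j hj => ?_) (Set.toFinite _)
      have hj' := hT j hj
      have hcj := hK.col_ne hj'
      exact ⟨col_eq_true.1 (by simpa [hc] using hcj),
        (hK.ic_iff _ _).2 ⟨by simpa [hc] using hcj, hj'.symm⟩⟩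
    · have := h1 i (col_eq_true.1 hc)
      refine lt_of_le_of_lt ?_ (show n - 1 < _ from Nat.sub_lt hn one_pos)
      refine le_trans ?_ this
      rw [← Set.ncard_coe_finset]
      refine Set.ncard_le_ncard (fun j hj => ?_) (Set.toFinite _)
      have hj' := hT j hj
      have hcj := hK.col_ne hj'
      exact ⟨(hK.ln_iff_col _).2 (by simpa [hc] using hcj),
        (hK.ic_iff _ _).2 ⟨hc, hj'⟩⟩
  · intro h
    constructor
    · intro i hi
      rw [Set.ncard_eq_toFinset_card _ (Set.toFinite _)]
      have := h i (Set.toFinite {j : Fin k | S.RelMap symL ![Sum.inl j] ∧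
        S.RelMap symI ![Sum.inr i, Sum.inl j]}).toFinset (by
          intro j hj
          exact Or.inl ((Set.Finite.mem_toFinset _).1 hj).2)
      rw [col_eq_true.2 hi] at this
      exact Nat.le_sub_one_of_lt this
    · intro i hi
      rw [Set.ncard_eq_toFinset_card _ (Set.toFinite _)]
      have := h i (Set.toFinite {j : Fin k | S.RelMap symP ![Sum.inl j] ∧
        S.RelMap symI ![Sum.inl j, Sum.inr i]}).toFinset (by
          intro j hj
          exact Or.inr ((Set.Finite.mem_toFinset _).1 hj).2)
      rw [(hK.ln_iff_col _).1 hi] at this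
      exact Nat.le_sub_one_of_lt this

theorem models_axExtension {k l : ℕ} [S : lang.Structure (Fin k ⊕ Fin l)] :
    M ⊨ axExtension S ↔ ∀ x : Fin k → M, SameType (Sum.inl : Fin k → Fin k ⊕ Fin l) x →
      ∃ y : Fin l → M, SameType (id : Fin k ⊕ Fin l → Fin k ⊕ Fin l) (Sum.elim x y) := by
  rw [axExtension, realize_forallAll]
  simp only [Formula.realize_imp, Formula.realize_iExs, realize_diag]
  refine forall_congr' fun x => imp_congr_left ?_
  let _ : lang.Structure (Fin k) := restrictLeft S
  exact ⟨fun h => ⟨fun a b => Sum.inl_injective.eq_iff.trans (h.1 a b), h.2, h.3, h.4⟩,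
    fun h => ⟨fun a b => Sum.inl_injective.eq_iff.symm.trans (h.1 a b), h.2, h.3, h.4⟩⟩

variable (m n) in
/-- Every safe extension of a finite part of the structure is realized. -/
def IsSaturatedForSafe (M : Type) [lang.Structure M] : Prop :=
  ∀ (k l : ℕ) (S : lang.Structure (Fin k ⊕ Fin l)), IsSafe m n S → ∀ x : Fin k → M,
    SameType (Sum.inl : Fin k → Fin k ⊕ Fin l) x →
      ∃ y : Fin l → M, SameType (id : Fin k ⊕ Fin l → Fin k ⊕ Fin l) (Sum.elim x y)

theorem models_Tmn :
    M ⊨ Tmn m n ↔ KFree m n M ∧ IsComplete m n M ∧ IsSaturatedForSafe m n M := by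
  rw [Tmn, Theory.model_union_iff, ← and_assoc]
  refine and_congr ⟨isComplete_of_models, fun h => models_Tc h.1 h.2⟩ ?_
  rw [Theory.model_iff]
  constructor
  · intro h k l S hS
    exact models_axExtension.1 (h _ ⟨k, l, S, hS, rfl⟩)
  · rintro h _ ⟨k, l, S, hS, rfl⟩
    exact models_axExtension.2 (h k l S hS)

end Models

end Incidence

namespace Incidence

/-! ### Free amalgamation -/

namespace FreeAmalgam

variable {A R : Type} {F X : R → Type} (f : ∀ ρ, X ρ → F ρ) (g : ∀ ρ, X ρ → A)

variable (A) in
/-- The domain of the free amalgam of the `F ρ` over `A`. -/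
abbrev Dom : Type := A ⊕ Σ ρ, {u : F ρ // u ∉ Set.range (f ρ)}

open Classical in
/-- The map of `F ρ` into the amalgam. -/
def emb (ρ : R) (u : F ρ) : Dom A f :=
  if h : u ∈ Set.range (f ρ) then Sum.inl (g ρ h.choose) else Sum.inr ⟨ρ, u, h⟩

variable {f g} in
theorem emb_of_notMem {ρ : R} {u : F ρ} (h : u ∉ Set.range (f ρ)) :
    emb f g ρ u = Sum.inr ⟨ρ, u, h⟩ := dif_neg h

variable [lang.Structure A] [∀ ρ, lang.Structure (F ρ)]

/-- The colouring of the amalgam. -/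
def color : Dom A f → Bool := Sum.elim col fun s => col s.2.1

/-- Adjacency in the amalgam. -/
def rel (u v : Dom A f) : Prop :=
  (∃ a a', Sum.inl a = u ∧ Sum.inl a' = v ∧ Adj a a') ∨
    ∃ ρ x x', emb f g ρ x = u ∧ emb f g ρ x' = v ∧ Adj x x'

variable {f g}

variable (hs : ∀ ρ, SameType (f ρ) (g ρ))
include hs

theorem emb_apply (ρ : R) (x : X ρ) : emb f g ρ (f ρ x) = Sum.inl (g ρ x) := by
  have h : f ρ x ∈ Set.range (f ρ) := ⟨x, rfl⟩
  rw [emb, dif_pos h]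
  exact congrArg _ (((hs ρ).eq_iff _ _).1 h.choose_spec)

theorem emb_eq_inl {ρ : R} {u : F ρ} {a : A} (h : emb f g ρ u = Sum.inl a) :
    ∃ x, f ρ x = u ∧ g ρ x = a := by
  by_cases hu : u ∈ Set.range (f ρ)
  · obtain ⟨x, rfl⟩ := hu
    rw [emb_apply hs] at h
    exact ⟨x, rfl, Sum.inl_injective h⟩
  · rw [emb_of_notMem hu] at h; simp at h

theorem emb_injective (ρ : R) : Function.Injective (emb f g ρ) := by
  intro u v h
  by_cases hu : u ∈ Set.range (f ρ)
  · obtain ⟨x, rfl⟩ := hu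
    rw [emb_apply hs] at h
    obtain ⟨y, rfl, hy⟩ := emb_eq_inl hs h.symm
    exact ((hs ρ).eq_iff _ _).2 hy.symm
  · by_cases hv : v ∈ Set.range (f ρ)
    · obtain ⟨x, rfl⟩ := hv
      rw [emb_apply hs] at h
      obtain ⟨y, rfl, hy⟩ := emb_eq_inl hs h
      exact absurd ⟨y, rfl⟩ hu
    · rw [emb_of_notMem hu, emb_of_notMem hv] at h
      simpa using h

/-- Elements outside the glued part carry their index, so a new element of one factor occurs in no
other. -/
theorem eq_of_emb_eq {ρ ρ' : R} {u : F ρ} {v : F ρ'} (hu : u ∉ Set.range (f ρ))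
    (h : emb f g ρ' v = emb f g ρ u) : ρ' = ρ := by
  by_cases hv : v ∈ Set.range (f ρ')
  · obtain ⟨x, rfl⟩ := hv
    rw [emb_apply hs] at h
    obtain ⟨y, rfl, hy⟩ := emb_eq_inl hs h.symm
    exact absurd ⟨y, rfl⟩ hu
  · rw [emb_of_notMem hu, emb_of_notMem hv] at h
    exact (Sigma.mk.inj_iff.1 (Sum.inr_injective h)).1

theorem color_emb (ρ : R) (u : F ρ) : color f (emb f g ρ u) = col u := by
  by_cases hu : u ∈ Set.range (f ρ)
  · obtain ⟨x, rfl⟩ := hu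
    rw [emb_apply hs]; exact ((hs ρ).col_eq x).symm
  · rw [emb_of_notMem hu]; rfl

/-- An edge coming from `A` or from another factor has both ends in the glued part, where `hs`
carries it back to `F ρ`. -/
theorem rel_emb (ρ : R) (u v : F ρ) : rel f g (emb f g ρ u) (emb f g ρ v) ↔ Adj u v := by
  refine ⟨?_, fun h => Or.inr ⟨ρ, u, v, rfl, rfl, h⟩⟩
  rintro (⟨a, a', ha, ha', h⟩ | ⟨ρ', x, x', hx, hx', h⟩)
  · obtain ⟨z, rfl, rfl⟩ := emb_eq_inl hs ha.symm
    obtain ⟨z', rfl, rfl⟩ := emb_eq_inl hs ha'.symm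
    exact ((hs ρ).adj_iff _ _).2 h
  · by_cases hu : u ∈ Set.range (f ρ)
    · by_cases hv : v ∈ Set.range (f ρ)
      · obtain ⟨z, rfl⟩ := hu
        obtain ⟨z', rfl⟩ := hv
        rw [emb_apply hs] at hx hx'
        obtain ⟨w, rfl, hw⟩ := emb_eq_inl hs hx
        obtain ⟨w', rfl, hw'⟩ := emb_eq_inl hs hx'
        rwa [(hs _).adj_iff, hw, hw', ← (hs _).adj_iff] at h
      · obtain rfl := eq_of_emb_eq hs hv hx'
        rwa [← emb_injective hs _ hx, ← emb_injective hs _ hx']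
    · obtain rfl := eq_of_emb_eq hs hu hx
      rwa [← emb_injective hs _ hx, ← emb_injective hs _ hx']

theorem rel_inl (a a' : A) : rel f g (Sum.inl a) (Sum.inl a') ↔ Adj a a' := by
  refine ⟨?_, fun h => Or.inl ⟨a, a', rfl, rfl, h⟩⟩
  rintro (⟨a, a', ha, ha', h⟩ | ⟨ρ', x, x', hx, hx', h⟩)
  · rwa [← Sum.inl_injective ha, ← Sum.inl_injective ha']
  · obtain ⟨w, rfl, rfl⟩ := emb_eq_inl hs hx
    obtain ⟨w', rfl, rfl⟩ := emb_eq_inl hs hx'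
    rwa [(hs _).adj_iff] at h

end FreeAmalgam

open FreeAmalgam in
/-- The free amalgam over `A` of free structures `F ρ`, each of them glued to `A` along a family
`X ρ` such that no new element has too many neighbours in `X ρ`, is free. -/
theorem exists_freeAmalgam_family {m n : ℕ} {A R : Type} {F X : R → Type} [lang.Structure A]
    [∀ ρ, lang.Structure (F ρ)] (hA : KFree m n A) (hF : ∀ ρ, KFree m n (F ρ))
    (f : ∀ ρ, X ρ → F ρ) (g : ∀ ρ, X ρ → A) (hs : ∀ ρ, SameType (f ρ) (g ρ))
    (hsafe : ∀ ρ x, x ∉ Set.range (f ρ) → ∀ T : Finset (F ρ), (∀ y ∈ T, y ∈ Set.range (f ρ)) →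
      (∀ y ∈ T, Adj x y) → T.card < sz m n (!col x)) :
    ∃ (G : Type) (_ : lang.Structure G) (α : A ↪[lang] G) (β : ∀ ρ, F ρ ↪[lang] G),
      KFree m n G ∧ (∀ ρ x, β ρ (f ρ x) = α (g ρ x)) ∧
      (∀ ρ u a, β ρ u = α a → ∃ x, f ρ x = u ∧ g ρ x = a) ∧
      (∀ u : G, (∃ a, α a = u) ∨ ∃ ρ x, β ρ x = u) ∧
      (∀ u v : G, Adj u v → (∃ a a', α a = u ∧ α a' = v) ∨
        ∃ ρ x x', β ρ x = u ∧ β ρ x' = v) := by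
  classical
  let G := Dom A f
  let _ : lang.Structure G := bip (color f) (rel f g)
  have hG : IsInc G := isInc_bip _ _
  have hsymm : ∀ x y, rel f g x y → rel f g y x := by
    rintro x y (⟨a, a', rfl, rfl, h⟩ | ⟨ρ, x, x', rfl, rfl, h⟩)
    · exact Or.inl ⟨_, _, rfl, rfl, h.symm⟩
    · exact Or.inr ⟨_, _, _, rfl, rfl, h.symm⟩
  have halt : ∀ x y, rel f g x y → color f y = !color f x := by
    rintro x y (⟨a, a', rfl, rfl, h⟩ | ⟨ρ, x, x', rfl, rfl, h⟩)
    · exact hA.col_ne h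
    · rw [color_emb hs, color_emb hs]; exact (hF ρ).col_ne h
  have hadj : ∀ x y : G, Adj x y ↔ rel f g x y := adj_bip hsymm halt
  let α : A ↪[lang] G := SameType.toEmbedding (e := Sum.inl)
    (SameType.of_col_adj hA.toIsInc hG (fun x y => Sum.inl_injective.eq_iff.symm)
      (fun x => (col_bip (color f) (rel f g) (Sum.inl x)).symm) (fun x y => by rw [hadj, rel_inl hs]; rfl))
  let β (ρ : R) : F ρ ↪[lang] G := SameType.toEmbedding (e := emb f g ρ)
    (SameType.of_col_adj (hF ρ).toIsInc hG (fun x y => (emb_injective hs ρ).eq_iff.symm)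
      (fun x => ((col_bip (color f) (rel f g) _).trans (color_emb hs ρ x)).symm)
      (fun x y => by rw [hadj, rel_emb hs]; rfl))
  have hcover : ∀ u : G, u ∉ Set.range α → ∃ ρ x, x ∉ Set.range (f ρ) ∧ β ρ x = u := by
    rintro (a | ⟨ρ, x, hx⟩) hu
    · exact absurd ⟨a, rfl⟩ hu
    · exact ⟨ρ, x, hx, emb_of_notMem hx⟩
  have hedge : ∀ u v : G, Adj u v → (∃ a a', α a = u ∧ α a' = v) ∨
      ∃ ρ x x', β ρ x = u ∧ β ρ x' = v := by
    intro u v h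
    rcases (hadj u v).1 h with ⟨a, a', rfl, rfl, h⟩ | ⟨ρ, x, x', rfl, rfl, h⟩
    · exact Or.inl ⟨a, a', rfl, rfl⟩
    · exact Or.inr ⟨ρ, x, x', rfl, rfl⟩
  have hnbr : ∀ ρ x, x ∉ Set.range (f ρ) → ∀ v : G, Adj (β ρ x) v → ∃ y, β ρ y = v := by
    intro ρ x hx v h
    rcases hedge _ _ h with ⟨a, a', ha, -⟩ | ⟨ρ', y, y', hy, rfl⟩
    · obtain ⟨z, hz, -⟩ := emb_eq_inl hs ha.symm
      exact absurd ⟨z, hz⟩ hx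
    · obtain rfl := eq_of_emb_eq hs hx hy
      exact ⟨y', rfl⟩
  -- If `S` contains a new element of `F ρ`, then `T` lies in `F ρ`. It cannot also lie in `A`, by
  -- `hsafe`, and a new element of `T` in turn pulls `S` into `F ρ`, which is free. A configuration
  -- without new elements lies in `A`, so no condition is needed on the elements of `A`.
  have key : ∀ c (S T : Finset G), (∀ x ∈ S, col x = c) → (∀ y ∈ T, col y = !c) →
      (∀ x ∈ S, ∀ y ∈ T, Adj x y) → sz m n c ≤ S.card → sz m n (!c) ≤ T.card →
      ∀ u ∈ S, u ∉ Set.range α → False := by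
    intro c S T hS hT hST h1 h2 u hu hu'
    obtain ⟨ρ, x, hx, rfl⟩ := hcover u hu'
    have hTρ : ∀ v ∈ T, v ∈ Set.range (β ρ) := fun v hv => hnbr ρ x hx v (hST _ hu v hv)
    have hex : ∃ v ∈ T, v ∉ Set.range α := by
      by_contra! hall
      obtain ⟨T', rfl, hT'⟩ := exists_finset_image (β ρ) (β ρ).injective T hTρ
      simp only [Finset.forall_mem_image] at hall hST
      refine (hsafe ρ x hx T' ?_ ?_).not_ge ?_
      · intro y hy
        obtain ⟨a, ha⟩ := hall hy
        obtain ⟨z, hz, -⟩ := emb_eq_inl hs ha.symm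
        exact ⟨z, hz⟩
      · intro y hy
        exact (adj_map (β ρ) _ _).1 (hST _ hu hy)
      · rw [hT', ← col_map (β ρ), hS _ hu]; exact h2
    obtain ⟨v, hv, hv'⟩ := hex
    obtain ⟨ρ', y, hy, rfl⟩ := hcover v hv'
    obtain ⟨z, hz⟩ := hTρ _ hv
    obtain rfl := eq_of_emb_eq hs hy hz
    exact (hF ρ).not_image (β ρ) hS hT hST h1 h2
      (fun w hw => hnbr ρ y hy w (hST w hw _ hv).symm) hTρ
  refine ⟨G, inferInstance, α, β, ⟨hG, ?_⟩, fun ρ x => emb_apply hs ρ x,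
    fun ρ u a h => emb_eq_inl hs h, ?_, hedge⟩
  · intro c S T hS hT hST h1 h2
    refine hA.not_image α hS hT hST h1 h2 ?_ ?_
    · intro u hu
      by_contra hu'
      exact key c S T hS hT hST h1 h2 u hu hu'
    · intro u hu
      by_contra hu'
      exact key (!c) T S hT (by simpa using hS) (fun x hx y hy => (hST y hy x hx).symm) h2
        (by simpa using h1) u hu hu'
  · intro u
    by_cases hu : u ∈ Set.range α
    · exact Or.inl hu
    · obtain ⟨ρ, x, -, h⟩ := hcover u hu
      exact Or.inr ⟨ρ, x, h⟩

/-- Free amalgamation of two free structures. -/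
theorem exists_freeAmalgam {m n : ℕ} {A F X : Type} [lang.Structure A]
    [lang.Structure F] (hA : KFree m n A) (hF : KFree m n F)
    (f : X → F) (g : X → A) (hs : SameType f g)
    (hsafe : ∀ x, x ∉ Set.range f → ∀ T : Finset F, (∀ y ∈ T, y ∈ Set.range f) →
      (∀ y ∈ T, Adj x y) → T.card < sz m n (!col x)) :
    ∃ (G : Type) (_ : lang.Structure G) (α : A ↪[lang] G) (β : F ↪[lang] G),
      KFree m n G ∧ (∀ x, β (f x) = α (g x)) ∧
      (∀ u a, β u = α a → ∃ x, f x = u ∧ g x = a) ∧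
      (∀ u : G, (∃ a, α a = u) ∨ ∃ x, β x = u) ∧
      (∀ u v : G, Adj u v → (∃ a a', α a = u ∧ α a' = v) ∨
        ∃ x x', β x = u ∧ β x' = v) := by
  obtain ⟨G, i, α, β, h1, h2, h3, h4, h5⟩ := exists_freeAmalgam_family (R := Unit)
    (F := fun _ => F) (X := fun _ => X) hA (fun _ => hF) (fun _ => f) (fun _ => g) (fun _ => hs)
    (fun _ => hsafe)
  refine ⟨G, i, α, β (), h1, h2 (), h3 (), fun u => ?_, fun u v h => ?_⟩
  · exact (h4 u).imp_right fun ⟨_, h⟩ => h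
  · exact (h5 u v h).imp_right fun ⟨_, h⟩ => h

/-- Free amalgamation over a complete structure. -/
theorem exists_freeAmalgam_of_complete {m n : ℕ} (hm : 1 ≤ m) (hn : 1 ≤ n) {A F X : Type}
    [lang.Structure A] [lang.Structure F] [lang.Structure X]
    (hX : IsComplete m n X) (hA : KFree m n A) (hF : KFree m n F)
    (f : X ↪[lang] F) (g : X ↪[lang] A) :
    ∃ (G : Type) (_ : lang.Structure G) (α : A ↪[lang] G) (β : F ↪[lang] G),
      KFree m n G ∧ (∀ x, β (f x) = α (g x)) ∧
      (∀ u a, β u = α a → ∃ x, f x = u ∧ g x = a) ∧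
      (∀ u : G, (∃ a, α a = u) ∨ ∃ x, β x = u) ∧
      (∀ u v : G, Adj u v → (∃ a a', α a = u ∧ α a' = v) ∨
        ∃ x x', β x = u ∧ β x' = v) := by
  refine exists_freeAmalgam hA hF f g
    ((sameType_map f id).symm.trans (sameType_map g id)) fun x hx T hT hadj => ?_
  by_contra! h
  exact hx (hX.closed hF hm hn f x T hT hadj h)

end Incidence

namespace Incidence

/-! ### Every free structure embeds in a model of `Tmn` -/

section Grow

variable (m n : ℕ) (A : Type) [lang.Structure A]

/-- The monochromatic sets of the critical size with too few common neighbours. -/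
structure Deficient where
  /-- The colour of the elements of the set. -/
  c : Bool
  /-- The set. -/
  S : Finset A
  col_eq : ∀ x ∈ S, col x = c
  card_eq : S.card = sz m n c
  few : ∀ T : Finset A, (∀ y ∈ T, col y = !c) → (∀ x ∈ S, ∀ y ∈ T, Adj x y) →
    T.card < sz m n (!c) - 1

variable {m n A}

theorem Deficient.ext' {w w' : Deficient m n A} (h : w.c = w'.c) (h' : w.S = w'.S) : w = w' := by
  cases w; cases w'; cases h; cases h'; rfl

/-- Adjacency after adding a common neighbour to every deficient set. -/
def growRel : A ⊕ Deficient m n A → A ⊕ Deficient m n A → Prop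
  | Sum.inl a, Sum.inl b => Adj a b
  | Sum.inl a, Sum.inr w => a ∈ w.S
  | Sum.inr w, Sum.inl a => a ∈ w.S
  | Sum.inr _, Sum.inr _ => False

/-- One new common neighbour can be added simultaneously to all deficient sets. -/
theorem exists_grow (hA : KFree m n A) :
    ∃ (B : Type) (_ : lang.Structure B) (i : A ↪[lang] B), KFree m n B ∧
      ∀ c (S T : Finset A), (∀ x ∈ S, col x = c) → S.card = sz m n c → (∀ y ∈ T, col y = !c) →
        (∀ x ∈ S, ∀ y ∈ T, Adj x y) → T.card < sz m n (!c) - 1 →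
        ∃ T' : Finset B, (∀ y ∈ T', col y = !c) ∧ (∀ x ∈ S, ∀ y ∈ T', Adj (i x) y) ∧
          T'.card = T.card + 1 := by
  classical
  let B := A ⊕ Deficient m n A
  let color : B → Bool := Sum.elim col fun w => !w.c
  let _ : lang.Structure B := bip color growRel
  have hB : IsInc B := isInc_bip _ _
  have hadj : ∀ x y : B, Adj x y ↔ growRel x y := adj_bip
    (by rintro (a | w) (b | w') h
        exacts [Adj.symm h, h, h, h])
    (by rintro (a | w) (b | w') h
        · exact hA.col_ne h
        · change (!w'.c) = !col a
          rw [w'.col_eq a h]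
        · change col b = !!w.c
          rw [w.col_eq b h, Bool.not_not]
        · exact h.elim)
  have hcol : ∀ x : B, col x = color x := col_bip _ _
  let i : A ↪[lang] B := SameType.toEmbedding (e := Sum.inl)
    (SameType.of_col_adj hA.toIsInc hB (fun x y => Sum.inl_injective.eq_iff.symm)
      (fun x => (hcol (Sum.inl x)).symm) (fun x y => (hadj (Sum.inl x) (Sum.inl y)).symm))
  -- New vertices are pairwise non-adjacent, so a new vertex in `T` puts `S` inside `A` and, by
  -- size, makes `S` equal to its deficient set. Then `T` contains only that new vertex and fewer
  -- than `sz - 1` old ones.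
  have key : ∀ c (S T : Finset B), (∀ x ∈ S, col x = c) → (∀ y ∈ T, col y = !c) →
      (∀ x ∈ S, ∀ y ∈ T, Adj x y) → sz m n c ≤ S.card → sz m n (!c) ≤ T.card →
      ∀ u ∈ T, u ∉ Set.range i → False := by
    rintro c S T hS hT hST h1 h2 (a | w) hu hu'
    · exact hu' ⟨a, rfl⟩
    have hwc : w.c = c := by
      have := hT _ hu
      rw [hcol] at this
      simpa using (show (!w.c) = !c from this)
    subst hwc
    have hSr : ∀ x ∈ S, x ∈ Set.range i := by
      rintro (a | w') hx
      · exact ⟨a, rfl⟩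
      · exact ((hadj _ _).1 (hST _ hx _ hu)).elim
    obtain ⟨S', rfl, hS'⟩ := exists_finset_image i i.injective S hSr
    simp only [Finset.forall_mem_image] at hS hST
    have hnew : ∀ w' : Deficient m n A, Sum.inr w' ∈ T → S' = w'.S := by
      intro w' hw'
      have hc : w'.c = w.c := by
        have := hT _ hw'
        rw [hcol] at this
        simpa using (show (!w'.c) = !w.c from this)
      refine Finset.eq_of_subset_of_card_le (fun x hx => (hadj _ _).1 (hST hx _ hw')) ?_
      rw [hS', w'.card_eq, hc]; exact h1
    have hsub : T ⊆ insert (Sum.inr w) ((T.preimage i i.injective.injOn).image i) := by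
      rintro (a | w') hy
      · exact Finset.mem_insert_of_mem
          (Finset.mem_image.2 ⟨a, Finset.mem_preimage.2 hy, rfl⟩)
      · have hc : w'.c = w.c := by
          have := hT _ hy
          rw [hcol] at this
          simpa using (show (!w'.c) = !w.c from this)
        rw [Deficient.ext' hc ((hnew w' hy).symm.trans (hnew w hu))]
        exact Finset.mem_insert_self _ _
    have hlt := w.few (T.preimage i i.injective.injOn)
      (fun y hy => by rw [← col_map i]; exact hT _ (Finset.mem_preimage.1 hy))
      (fun x hx y hy => (adj_map i _ _).1
        (hST ((hnew w hu).symm ▸ hx) _ (Finset.mem_preimage.1 hy)))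
    have hle := (Finset.card_le_card hsub).trans (Finset.card_insert_le _ _)
    rw [Finset.card_image_of_injective _ i.injective] at hle
    omega
  refine ⟨B, inferInstance, i, ⟨hB, ?_⟩, ?_⟩
  · intro c S T hS hT hST h1 h2
    refine hA.not_image i hS hT hST h1 h2 ?_ ?_
    · intro u hu
      by_contra hu'
      exact key (!c) T S hT (by simpa using hS) (fun x hx y hy => (hST y hy x hx).symm) h2
        (by simpa using h1) u hu hu'
    · intro u hu
      by_contra hu'
      exact key c S T hS hT hST h1 h2 u hu hu'
  · intro c S T hS hSc hT hST hlt
    by_cases h : ∃ T₂ : Finset A, (∀ y ∈ T₂, col y = !c) ∧ (∀ x ∈ S, ∀ y ∈ T₂, Adj x y) ∧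
      T.card + 1 ≤ T₂.card
    · obtain ⟨T₂, h1, h2, h3⟩ := h
      obtain ⟨T₃, hT₃, hc⟩ := Finset.exists_subset_card_eq h3
      refine ⟨T₃.image i, ?_, ?_, ?_⟩
      · simpa only [Finset.forall_mem_image, col_map] using fun y hy => h1 y (hT₃ hy)
      · simpa only [Finset.forall_mem_image, adj_map] using fun x hx y hy => h2 x hx y (hT₃ hy)
      · rw [Finset.card_image_of_injective _ i.injective, hc]
    · push Not at h
      let w : Deficient m n A := ⟨c, S, hS, hSc, fun T₂ h1 h2 => by have := h T₂ h1 h2; omega⟩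
      have hw : (Sum.inr w : B) ∉ T.image i := by
        intro hmem
        obtain ⟨a, -, ha⟩ := Finset.mem_image.1 hmem
        exact absurd (show (Sum.inl a : B) = Sum.inr w from ha) (by simp)
      refine ⟨insert (Sum.inr w) (T.image i), ?_, ?_, ?_⟩
      · simp only [Finset.mem_insert, forall_eq_or_imp, Finset.forall_mem_image, col_map]
        exact ⟨hcol _, hT⟩
      · simp only [Finset.mem_insert, forall_eq_or_imp, Finset.forall_mem_image, adj_map]
        exact fun x hx => ⟨(hadj _ _).2 hx, hST x hx⟩
      · rw [Finset.card_insert_of_notMem hw, Finset.card_image_of_injective _ i.injective]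

variable (m n A) in
/-- A safe extension of a finite part of `A`. -/
structure Requirement where
  /-- The number of elements of `A` involved. -/
  k : ℕ
  /-- The number of new elements. -/
  l : ℕ
  /-- The extension. -/
  S : lang.Structure (Fin k ⊕ Fin l)
  /-- The finite part of `A`. -/
  x : Fin k → A
  safe : IsSafe m n S
  same : SameType (Sum.inl : Fin k → Fin k ⊕ Fin l) x

/-- All safe extensions of finite parts can be realized simultaneously. -/
theorem exists_realizing (hm : 1 ≤ m) (hn : 1 ≤ n) (hA : KFree m n A) :
    ∃ (B : Type) (_ : lang.Structure B) (i : A ↪[lang] B), KFree m n B ∧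
      ∀ (k l : ℕ) (S : lang.Structure (Fin k ⊕ Fin l)), IsSafe m n S → ∀ x : Fin k → A,
        SameType (Sum.inl : Fin k → Fin k ⊕ Fin l) x → ∃ y : Fin l → B,
          SameType (id : Fin k ⊕ Fin l → Fin k ⊕ Fin l) (Sum.elim (fun j => i (x j)) y) := by
  classical
  let _ (ρ : Requirement m n A) : lang.Structure (Fin ρ.k ⊕ Fin ρ.l) := ρ.S
  obtain ⟨B, iB, α, β, hB, h, -⟩ := exists_freeAmalgam_family (R := Requirement m n A)
    (F := fun ρ => Fin ρ.k ⊕ Fin ρ.l) (X := fun ρ => Fin ρ.k) hA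
    (fun ρ => ((isSafe_iff hm hn).1 ρ.safe).1) (fun ρ => Sum.inl) (fun ρ => ρ.x)
    (fun ρ => ρ.same) (by
      rintro ρ (j | j) hx T hT hadj
      · exact absurd ⟨j, rfl⟩ hx
      · obtain ⟨T', rfl, hT'⟩ := exists_finset_image _ Sum.inl_injective T hT
        rw [← hT']
        exact ((isSafe_iff hm hn).1 ρ.safe).2 j T' fun a ha =>
          hadj _ (Finset.mem_image_of_mem _ ha))
  refine ⟨B, iB, α, hB, fun k l S hS x hx => ?_⟩
  let ρ : Requirement m n A := ⟨k, l, S, x, hS, hx⟩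
  refine ⟨fun j => β ρ (Sum.inr j), ?_⟩
  have := sameType_map (β ρ) id
  convert! this using 1
  ext (j | j)
  · exact (h ρ j).symm
  · rfl

end Grow

/-! ### Limits of chains and the construction of models -/

section Limit

/-- A countable chain of embeddings has a limit. -/
theorem exists_limit (G : ℕ → Type) [∀ k, lang.Structure (G k)]
    (f : ∀ k, G k ↪[lang] G (k + 1)) :
    ∃ (H : Type) (_ : lang.Structure H) (ι : ∀ k, G k ↪[lang] H),
      (∀ k x, ι (k + 1) (f k x) = ι k x) ∧
      ∀ s : Finset H, ∃ k, ∀ x ∈ s, x ∈ Set.range (ι k) := by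
  classical
  let F := fun i j h => DirectedSystem.natLERec f i j h
  let ι : ∀ k, G k ↪[lang] Language.DirectLimit G F := fun k => Language.DirectLimit.of lang ℕ G F k
  have hF : ∀ i j (h : i ≤ j) x, ι j (F i j h x) = ι i x := fun i j h x =>
    Language.DirectLimit.of_f (f := F) (hij := h)
  refine ⟨Language.DirectLimit G F, inferInstance, ι, fun k x => ?_, fun s => ?_⟩
  · rw [← hF k (k + 1) (Nat.le_succ k) x]
    congr 1
    simp [F, Nat.leRecOn_succ']
  · induction s using Finset.induction_on with
    | empty => exact ⟨0, by simp⟩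
    | insert a s _ ih =>
      obtain ⟨k, hk⟩ := ih
      obtain ⟨j, y, rfl⟩ := Language.DirectLimit.exists_of a
      refine ⟨max k j, fun x hx => ?_⟩
      rcases Finset.mem_insert.1 hx with rfl | hx
      · exact ⟨F j _ (le_max_right _ _) y, hF _ _ _ _⟩
      · obtain ⟨z, rfl⟩ := hk x hx
        exact ⟨F k _ (le_max_left _ _) z, hF _ _ _ _⟩

variable (m n : ℕ)

/-- A free structure bundled with its domain. -/
structure FreeObj where
  /-- The domain. -/
  carrier : Type
  [str : lang.Structure carrier]
  free : KFree m n carrier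

attribute [instance] FreeObj.str

variable {m n}

/-- `B` realizes all that is required over `A`. -/
structure IsStep {A B : Type} [lang.Structure A] [lang.Structure B] (m n : ℕ)
    (i : A ↪[lang] B) : Prop where
  grow : ∀ c (S T : Finset A), (∀ x ∈ S, col x = c) → S.card = sz m n c → (∀ y ∈ T, col y = !c) →
    (∀ x ∈ S, ∀ y ∈ T, Adj x y) → T.card < sz m n (!c) - 1 →
    ∃ T' : Finset B, (∀ y ∈ T', col y = !c) ∧ (∀ x ∈ S, ∀ y ∈ T', Adj (i x) y) ∧
      T'.card = T.card + 1
  realize : ∀ (k l : ℕ) (S : lang.Structure (Fin k ⊕ Fin l)), IsSafe m n S → ∀ x : Fin k → A,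
    SameType (Sum.inl : Fin k → Fin k ⊕ Fin l) x → ∃ y : Fin l → B,
      SameType (id : Fin k ⊕ Fin l → Fin k ⊕ Fin l) (Sum.elim (fun j => i (x j)) y)

/-- Missing neighbours are added first; finite parts of `A` keep their quantifier-free type in the
enlarged structure, so their safe extensions can be realized over it. -/
theorem exists_step (hm : 1 ≤ m) (hn : 1 ≤ n) (A : FreeObj m n) :
    ∃ (B : FreeObj m n) (i : A.carrier ↪[lang] B.carrier), IsStep m n i := by
  classical
  obtain ⟨B, _, i, hB, h⟩ := exists_grow A.free
  obtain ⟨C, _, j, hC, h'⟩ := exists_realizing hm hn hB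
  refine ⟨⟨C, hC⟩, j.comp i, ⟨?_, ?_⟩⟩
  · intro c S T hS hSc hT hST hlt
    obtain ⟨T', h1, h2, h3⟩ := h c S T hS hSc hT hST hlt
    refine ⟨T'.image j, ?_, ?_, ?_⟩
    · simpa only [Finset.forall_mem_image, col_map] using h1
    · simpa only [Finset.forall_mem_image, Embedding.comp_apply, adj_map] using h2
    · rw [Finset.card_image_of_injective _ j.injective, h3]
  · intro k l S hS x hx
    exact h' k l S hS (fun a => i (x a)) (hx.trans (sameType_map i x))

/-- Every free structure embeds in a model of `Tmn`. -/
theorem exists_model (hm : 1 ≤ m) (hn : 1 ≤ n) (A : Type) [lang.Structure A] (hA : KFree m n A) :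
    ∃ (H : Type) (_ : lang.Structure H) (_ : A ↪[lang] H), H ⊨ Tmn m n := by
  classical
  choose next emb hstep using exists_step (m := m) (n := n) hm hn
  let chain : ℕ → FreeObj m n := fun k => next^[k] ⟨A, hA⟩
  have hsucc : ∀ k, chain (k + 1) = next (chain k) := fun k => Function.iterate_succ_apply' _ _ _
  have hex : ∀ k, ∃ i : (chain k).carrier ↪[lang] (chain (k + 1)).carrier, IsStep m n i := fun k => by
    rw [hsucc]; exact ⟨_, hstep _⟩
  choose f hf using hex
  obtain ⟨H, iH, ι, hι, hfin⟩ := exists_limit (fun k => (chain k).carrier) f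
  have hfin2 : ∀ S T : Finset H, ∃ k, ∃ S' T' : Finset (chain k).carrier,
      S'.image (ι k) = S ∧ S'.card = S.card ∧ T'.image (ι k) = T ∧ T'.card = T.card := by
    intro S T
    obtain ⟨k, hk⟩ := hfin (S ∪ T)
    obtain ⟨S', h1, h2⟩ := exists_finset_image (ι k) (ι k).injective S
      fun y hy => hk y (Finset.mem_union_left _ hy)
    obtain ⟨T', h3, h4⟩ := exists_finset_image (ι k) (ι k).injective T
      fun y hy => hk y (Finset.mem_union_right _ hy)
    exact ⟨k, S', T', h1, h2, h3, h4⟩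
  have hInc : IsInc H := by
    have h1 : ∀ x y : H, ∃ k, ∃ x' y', ι k x' = x ∧ ι k y' = y := fun x y => by
      obtain ⟨k, hk⟩ := hfin {x, y}
      obtain ⟨x', hx'⟩ := hk x (by simp)
      obtain ⟨y', hy'⟩ := hk y (by simp)
      exact ⟨k, x', y', hx', hy'⟩
    refine ⟨fun x => ?_, fun x => ?_, fun x y => ?_⟩
    · obtain ⟨k, x, -, rfl, -⟩ := h1 x x
      rw [pt_map, ln_map]; exact (chain k).free.cover x
    · obtain ⟨k, x, -, rfl, -⟩ := h1 x x
      rw [pt_map, ln_map]; exact (chain k).free.disjoint x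
    · obtain ⟨k, x, y, rfl, rfl⟩ := h1 x y
      rw [pt_map, ln_map, ic_map]; exact (chain k).free.incidence x y
  refine ⟨H, iH, ι 0, models_Tmn.2 ⟨⟨hInc, ?_⟩, ?_, ?_⟩⟩
  · intro c S T hS hT hST h1 h2
    obtain ⟨k, hk⟩ := hfin (S ∪ T)
    exact (chain k).free.not_image (ι k) hS hT hST h1 h2
      (fun y hy => hk y (Finset.mem_union_left _ hy))
      (fun y hy => hk y (Finset.mem_union_right _ hy))
  · intro c S hS hSc
    -- A stage supplies only one additional common neighbour, so the full number is reached by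
    -- induction, moving up the chain each time.
    have : ∀ t ≤ sz m n (!c) - 1, ∃ T : Finset H, (∀ y ∈ T, col y = !c) ∧
        (∀ x ∈ S, ∀ y ∈ T, Adj x y) ∧ T.card = t := by
      intro t
      induction t with
      | zero => exact fun _ => ⟨∅, by simp⟩
      | succ t ih =>
        intro ht
        obtain ⟨T, hT, hST, hTc⟩ := ih (by omega)
        obtain ⟨k, S, T, rfl, hSc', rfl, hTc'⟩ := hfin2 S T
        simp only [Finset.forall_mem_image, col_map, adj_map] at hS hT hST
        obtain ⟨T', h1, h2, h3⟩ := (hf k).grow c S T hS (by omega) hT hST (by omega)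
        refine ⟨T'.image (ι (k + 1)), ?_, ?_, ?_⟩
        · simp only [Finset.forall_mem_image, col_map]; exact h1
        · simp only [Finset.forall_mem_image]
          intro x hx y hy
          rw [← hι, adj_map]
          exact h2 x hx y hy
        · rw [Finset.card_image_of_injective _ (ι (k + 1)).injective]; omega
    exact this _ le_rfl
  · intro k l S hS x hx
    obtain ⟨j, hj⟩ := hfin (Finset.univ.image x)
    choose x' hx' using fun a => hj (x a) (by simp)
    have hxx : x = fun a => ι j (x' a) := funext fun a => (hx' a).symm
    subst hxx
    obtain ⟨y, hy⟩ := (hf j).realize k l S hS x' (hx.trans (sameType_map (ι j) x').symm)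
    refine ⟨fun a => ι (j + 1) (y a), ?_⟩
    have := hy.trans (sameType_map (ι (j + 1)) _)
    convert! this using 1
    ext (a | a)
    · exact (hι j (x' a)).symm
    · rfl

end Limit

end Incidence

namespace Incidence

/-! ### Ultrapowers -/

section Ultrapower

/-- The ultrapower of `N`. -/
abbrev UPow {J : Type} (U : Ultrafilter J) (N : Type) : Type := (U : Filter J).Product fun _ => N

variable {J : Type} (U : Ultrafilter J) {N N' A X : Type}

/-- The class of a sequence in the ultrapower. -/
def up (f : J → N) : UPow U N := (f : (U : Filter J).Product fun _ => N)

theorem up_surjective : Function.Surjective (up U : (J → N) → UPow U N) := Quotient.mk_surjective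

variable {U}

theorem up_eq {f g : J → N} : up U f = up U g ↔ ∀ᶠ j in (U : Filter J), f j = g j := Quotient.eq''

variable [lang.Structure N] [lang.Structure N'] [lang.Structure A]
variable [Nonempty N] [Nonempty N']

theorem realize_up {β : Type} (φ : lang.Formula β) (x : β → J → N) :
    φ.Realize (fun b => up U (x b)) ↔ ∀ᶠ j in (U : Filter J), φ.Realize fun b => x b j :=
  Ultraproduct.realize_formula_cast φ x

theorem pt_up (f : J → N) : Pt (up U f) ↔ ∀ᶠ j in (U : Filter J), Pt (f j) := by
  simpa using realize_up (U := U) (isPt ()) fun _ => f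

theorem ln_up (f : J → N) : Ln (up U f) ↔ ∀ᶠ j in (U : Filter J), Ln (f j) := by
  simpa using realize_up (U := U) (isLn ()) fun _ => f

theorem ic_up (f g : J → N) : Ic (up U f) (up U g) ↔ ∀ᶠ j in (U : Filter J), Ic (f j) (g j) := by
  simpa using realize_up (U := U) (inc false true) fun b => cond b g f

theorem adj_up (f g : J → N) :
    Adj (up U f) (up U g) ↔ ∀ᶠ j in (U : Filter J), Adj (f j) (g j) := by
  simp only [Adj, ic_up, Ultrafilter.eventually_or]

/-- The relations are at most binary, so agreement on pairs suffices, and the large set of indices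
may depend on the pair. -/
theorem sameType_up (f : X → J → N) (g : X → A)
    (h : ∀ x y, ∀ᶠ j in (U : Filter J), SameType (fun b => cond b (f x j) (f y j))
      (fun b => cond b (g x) (g y))) : SameType (fun x => up U (f x)) g where
  eq_iff x y := by
    rw [up_eq, ← Filter.eventually_const (f := (U : Filter J)) (p := g x = g y)]
    exact Filter.eventually_congr ((h x y).mono fun j hj => hj.eq_iff true false)
  pt_iff x := by
    rw [pt_up, ← Filter.eventually_const (f := (U : Filter J)) (p := Pt (g x))]
    exact Filter.eventually_congr ((h x x).mono fun j hj => hj.pt_iff true)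
  ln_iff x := by
    rw [ln_up, ← Filter.eventually_const (f := (U : Filter J)) (p := Ln (g x))]
    exact Filter.eventually_congr ((h x x).mono fun j hj => hj.ln_iff true)
  ic_iff x y := by
    rw [ic_up, ← Filter.eventually_const (f := (U : Filter J)) (p := Ic (g x) (g y))]
    exact Filter.eventually_congr ((h x y).mono fun j hj => hj.ic_iff true false)

variable (U N) in
/-- The diagonal embedding into the ultrapower. -/
def diagEmb : N ↪[lang] UPow U N :=
  SameType.toEmbedding (e := fun x => up U fun _ => x)
    (sameType_up (fun x _ => x) id fun _ _ => Filter.Eventually.of_forall fun _ =>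
      ⟨fun _ _ => Iff.rfl, fun _ => Iff.rfl, fun _ => Iff.rfl, fun _ _ => Iff.rfl⟩).symm

theorem diagEmb_apply (x : N) : diagEmb U N x = up U fun _ => x := rfl

/-- Łoś's theorem for constant sequences: the diagonal embedding is elementary. -/
theorem boundedRealize_diagEmb {β : Type} {k : ℕ} (φ : lang.BoundedFormula β k) (x : β → N)
    (v : Fin k → N) :
    φ.Realize (fun b => diagEmb U N (x b)) (fun b => diagEmb U N (v b)) ↔ φ.Realize x v := by
  have := Ultraproduct.boundedFormula_realize_cast (u := U) φ (fun b _ => x b) fun b _ => v b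
  rw [Filter.eventually_const] at this
  exact this

theorem models_upow {T : lang.Theory} (h : N ⊨ T) : UPow U N ⊨ T := by
  rw [Theory.model_iff] at h ⊢
  exact fun φ hφ => (Ultraproduct.sentence_realize φ).2 (Filter.Eventually.of_forall fun _ => h φ hφ)

instance : Nonempty (UPow U N) := ⟨diagEmb U N (Classical.arbitrary N)⟩

variable (U) in
/-- The embedding of ultrapowers induced by an embedding. -/
def upMap (e : N ↪[lang] N') : UPow U N ↪[lang] UPow U N' :=
  SameType.toEmbedding (e := Quotient.map' (fun f j => e (f j))
      (fun _ _ h => h.mono fun _ hj => congrArg e hj))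
    { eq_iff := by
        refine (up_surjective U).forall.2 fun f => (up_surjective U).forall.2 fun g => ?_
        refine up_eq.trans (Iff.trans ?_ up_eq.symm)
        exact Filter.eventually_congr (Filter.Eventually.of_forall fun j => e.injective.eq_iff.symm)
      pt_iff := by
        refine (up_surjective U).forall.2 fun f => (pt_up f).trans (Iff.trans ?_ (pt_up _).symm)
        exact Filter.eventually_congr (Filter.Eventually.of_forall fun j => (pt_map e _).symm)
      ln_iff := by
        refine (up_surjective U).forall.2 fun f => (ln_up f).trans (Iff.trans ?_ (ln_up _).symm)
        exact Filter.eventually_congr (Filter.Eventually.of_forall fun j => (ln_map e _).symm)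
      ic_iff := by
        refine (up_surjective U).forall.2 fun f => (up_surjective U).forall.2 fun g => ?_
        refine (ic_up f g).trans (Iff.trans ?_ (ic_up _ _).symm)
        exact Filter.eventually_congr (Filter.Eventually.of_forall fun j => (ic_map e _ _).symm) }

theorem upMap_up (e : N ↪[lang] N') (f : J → N) : upMap U e (up U f) = up U fun j => e (f j) := rfl

theorem upMap_diagEmb (e : N ↪[lang] N') (x : N) :
    upMap U e (diagEmb U N x) = diagEmb U N' (e x) := rfl

omit [Nonempty N] in
/-- If all finite parts of `N` embed in `N'`, compatibly with a labelling, then `N` embeds in an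
ultrapower of `N'`. -/
theorem exists_embedding_upow {κ : Type} (c : κ → N) (c' : κ → N')
    (h : ∀ (s : Finset N) (t : Finset κ), ∃ g : N → N',
      SameType (fun x : s => (x : N)) (fun x : s => g x) ∧ ∀ k ∈ t, g (c k) = c' k) :
    ∃ (J : Type) (V : Ultrafilter J) (e : N ↪[lang] UPow V N'),
      ∀ k, e (c k) = diagEmb V N' (c' k) := by
  classical
  choose g hg hgc using h
  -- Refining `atTop` makes almost every index contain any given finite data, so the partial maps
  -- fit together into an embedding.
  let V : Ultrafilter (Finset N × Finset κ) := Ultrafilter.of Filter.atTop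
  have hV : ∀ j, ∀ᶠ i in (V : Filter (Finset N × Finset κ)), j ≤ i := fun j =>
    (Ultrafilter.of_le Filter.atTop) (Filter.mem_atTop j)
  refine ⟨_, V, SameType.toEmbedding (e := fun x => up V fun j : Finset N × Finset κ => g j.1 j.2 x) ?_, ?_⟩
  · refine (sameType_up (fun x (j : Finset N × Finset κ) => g j.1 j.2 x) id fun x y => ?_).symm
    refine (hV ({x, y}, ∅)).mono fun j hj => ?_
    have hx : x ∈ j.1 := hj.1 (by simp)
    have hy : y ∈ j.1 := hj.1 (by simp)
    have := (hg j.1 j.2).symm.comp fun b : Bool => cond b (⟨x, hx⟩ : j.1) ⟨y, hy⟩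
    convert! this using 1 <;> ext b <;> cases b <;> rfl
  · intro k
    refine up_eq.2 ((hV (∅, {k})).mono fun j hj => hgc _ _ _ (hj.2 (by simp)))

end Ultrapower

/-! ### Model completeness -/

section ModelComplete

variable {m n : ℕ}

/-- The structure induced on the labels. -/
@[reducible] def induced {X N : Type} [lang.Structure N] (w : X → N) : lang.Structure X :=
  mkStructure (fun x => Pt (w x)) (fun x => Ln (w x)) (fun x y => Ic (w x) (w y))

theorem sameType_induced {X N : Type} [lang.Structure N] {w : X → N} (hw : Function.Injective w) :
    @SameType X N X (induced w) _ id w :=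
  let _ := induced w
  ⟨fun _ _ => hw.eq_iff.symm, fun _ => Iff.rfl, fun _ => Iff.rfl, fun _ _ => Iff.rfl⟩

/-- Models of `Tmn` are existentially closed among free structures. -/
theorem exists_finite_retraction (hm : 1 ≤ m) (hn : 1 ≤ n) {H N : Type} [lang.Structure H]
    [lang.Structure N] [Nonempty H] (hH : H ⊨ Tmn m n) (hN : KFree m n N) (f : H ↪[lang] N)
    (s : Finset N) (t : Finset H) : ∃ g : N → H,
      SameType (fun x : s => (x : N)) (fun x : s => g x) ∧ ∀ k ∈ t, g (f k) = k := by
  classical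
  obtain ⟨-, hC, hsat⟩ := models_Tmn.1 hH
  let s₁ := s ∪ t.image f
  obtain ⟨a, ha, has⟩ := exists_enum (s₁.filter (· ∈ Set.range f)) rfl
  obtain ⟨b, hb, hbs⟩ := exists_enum (s₁.filter (· ∉ Set.range f)) rfl
  have haf : ∀ i, a i ∈ Set.range f := fun i => (Finset.mem_filter.1 ((has _).2 ⟨i, rfl⟩)).2
  have hbf : ∀ i, b i ∉ Set.range f := fun i => (Finset.mem_filter.1 ((hbs _).2 ⟨i, rfl⟩)).2
  choose a' ha' using haf
  have hw : Function.Injective (Sum.elim a b) :=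
    ha.sumElim hb fun i j hij => hbf j (hij ▸ ⟨a' i, ha' i⟩)
  have hcover : ∀ x ∈ s₁, ∃ z, Sum.elim a b z = x := by
    intro x hx
    by_cases hxf : x ∈ Set.range f
    · obtain ⟨i, hi⟩ := (has x).1 (Finset.mem_filter.2 ⟨hx, hxf⟩)
      exact ⟨Sum.inl i, hi⟩
    · obtain ⟨i, hi⟩ := (hbs x).1 (Finset.mem_filter.2 ⟨hx, hxf⟩)
      exact ⟨Sum.inr i, hi⟩
  let S := induced (Sum.elim a b)
  let e := (sameType_induced hw).toEmbedding
  have hS := hN.of_embedding (hN.toIsInc.of_embedding e) e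
  -- The elements `b i` lie outside the copy of `H`, which is closed in `N`; hence they have few
  -- neighbours among the `a j`.
  have hsafe : IsSafe m n S := by
    rw [isSafe_iff hm hn]
    refine ⟨hS, fun i T hT => ?_⟩
    by_contra! hcard
    refine hbf i (hC.closed hN hm hn f (b i) (T.image a) ?_ ?_ ?_)
    · simpa using fun j _ => ⟨a' j, ha' j⟩
    · simp only [Finset.forall_mem_image]
      exact fun j hj => (adj_map e _ _).2 (hT j hj)
    · rw [Finset.card_image_of_injective _ ha]
      exact (congrArg (fun c => sz m n (!c)) (col_map e (Sum.inr i))).trans_le hcard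
  have hsame : SameType (Sum.inl : Fin (s₁.filter (· ∈ Set.range f)).card →
      _ ⊕ Fin (s₁.filter (· ∉ Set.range f)).card) a' := by
    refine (show SameType Sum.inl a from sameType_map e Sum.inl).trans ?_
    rw [show a = fun i => f (a' i) from funext fun i => (ha' i).symm]
    exact (sameType_map f a').symm
  obtain ⟨y, hy⟩ := hsat _ _ S hsafe a' hsame
  refine ⟨Function.extend (Sum.elim a b) (Sum.elim a' y) fun _ => Classical.arbitrary H, ?_, ?_⟩
  · choose z hz using fun x : s => hcover x (Finset.mem_union_left _ x.2)
    have := ((sameType_induced hw).symm.trans hy).comp z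
    rw [show (fun x : s => (x : N)) = Sum.elim a b ∘ z from funext fun x => (hz x).symm]
    convert! this using 1
    ext x
    rw [← hz x, hw.extend_apply]; rfl
  · intro k hk
    obtain ⟨i, hi⟩ := (has (f k)).1 (Finset.mem_filter.2
      ⟨Finset.mem_union_right _ (Finset.mem_image_of_mem f hk), ⟨k, rfl⟩⟩)
    rw [show f k = Sum.elim a b (Sum.inl i) from hi.symm, hw.extend_apply]
    exact f.injective ((ha' i).trans hi)

/-- Existential closedness gives `e : N' → UPow V N` whose composite with `f` is the diagonal
embedding. A universal statement true in `N` passes to the ultrapower by Łoś and comes back to `N'`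
by the induction hypothesis for `e`, which is why the induction ranges over all pairs of models. -/
theorem boundedRealize_map (hm : 1 ≤ m) (hn : 1 ≤ n) {α : Type} {k : ℕ}
    (φ : lang.BoundedFormula α k) : ∀ {N N' : Type} [lang.Structure N] [lang.Structure N']
    [Nonempty N], N ⊨ Tmn m n → N' ⊨ Tmn m n → ∀ (f : N ↪[lang] N') (v : α → N) (w : Fin k → N),
      φ.Realize (f ∘ v) (f ∘ w) ↔ φ.Realize v w := by
  induction φ with
  | falsum => intros; rfl
  | equal t₁ t₂ =>
    intro N N' _ _ _ _ _ f v w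
    exact (BoundedFormula.IsAtomic.equal t₁ t₂).isQF.realize_embedding f
  | rel R ts =>
    intro N N' _ _ _ _ _ f v w
    exact (BoundedFormula.IsAtomic.rel R ts).isQF.realize_embedding f
  | imp φ ψ ih ih' =>
    intro N N' _ _ _ h h' f v w
    simp only [BoundedFormula.realize_imp, ih h h', ih' h h']
  | all φ ih =>
    intro N N' _ _ _ h h' f v w
    constructor
    · intro hall x
      rw [← ih h h' f, Fin.comp_snoc]
      exact hall (f x)
    · intro hall x
      have hN' := (models_Tmn.1 h').1
      obtain ⟨J, V, e, he⟩ := exists_embedding_upow f id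
        (exists_finite_retraction hm hn h hN' f)
      have : Nonempty N' := ⟨x⟩
      rw [← ih h' (models_upow (U := V) h) e, Fin.comp_snoc]
      have h1 := (boundedRealize_diagEmb (U := V) φ.all v w).2 hall
      rw [show e ∘ f ∘ v = fun b => diagEmb V N (v b) from funext fun b => he (v b),
        show e ∘ f ∘ w = fun b => diagEmb V N (w b) from funext fun b => he (w b)]
      exact h1 (e x)

/-- Embeddings between models of `Tmn` are elementary. -/
theorem realize_map (hm : 1 ≤ m) (hn : 1 ≤ n) {α N N' : Type} [lang.Structure N]
    [lang.Structure N'] [Nonempty N] (h : N ⊨ Tmn m n) (h' : N' ⊨ Tmn m n) (f : N ↪[lang] N')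
    (φ : lang.Formula α) (v : α → N) : φ.Realize (fun a => f (v a)) ↔ φ.Realize v := by
  have := boundedRealize_map hm hn φ h h' f v default
  rwa [Unique.eq_default (f ∘ default)] at this

end ModelComplete

end Incidence

/-! ### TP₂ implies the tree property -/

namespace Classification

variable {L : FirstOrder.Language.{0, 0}}

/-- A formula with TP₂ has the tree property. -/
theorem HasTP2.hasTP {T : L.Theory} {α β : Type} {φ : L.Formula (α ⊕ β)} (h : HasTP2 T φ) :
    HasTP T φ := by
  classical
  obtain ⟨M, k, a, hk, hrow, hpath⟩ := h
  -- The length of a node selects the row and its last entry the column, so siblings share a row and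
  -- branches are paths. The default `0` matters only at the root.
  refine ⟨M, k, fun s => a s.length (s.getLastD 0), hk, fun η => ?_, fun s => ?_⟩
  · have := hpath fun i => ((List.range i).map η).getLastD 0
    intro t
    obtain ⟨x, hx⟩ := this t
    exact ⟨x, fun i hi => by simpa using hx i hi⟩
  · intro t ht
    simpa using hrow (s.length + 1) t ht

end Classification

namespace Incidence

/-! ### A configuration witnessing TP₂ -/

/-- The elements of the configuration: an array of points `b i j` with rows of lines `c i`, lines
`ell S` completing all `m`-sets of these points, and for each path `σ` elements witnessing that
the formula is satisfied along `σ`. -/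
inductive Config (m n : ℕ) : Type
  | b (i j : ℕ)
  | x₁ (σ : ℕ → ℕ)
  | w (σ : ℕ → ℕ) (i : ℕ) (r : Fin (m - 1))
  | ell (S : Finset (ℕ × ℕ)) (hS : S.card = m) (r : Fin (n - 1))
  | c (i : ℕ) (t : Fin n)
  | x₂ (σ : ℕ → ℕ)
  | z (σ : ℕ → ℕ) (i : ℕ)

namespace Config

variable {m n : ℕ}

/-- The points of the configuration. -/
def isPoint : Config m n → Prop
  | b _ _ => True
  | x₁ _ => True
  | w _ _ _ => True
  | _ => False

/-- The incidences of the configuration. -/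
def rel : Config m n → Config m n → Prop
  | b i j, z σ k => i = k ∧ σ i = j
  | b i j, ell S _ _ => (i, j) ∈ S
  | x₁ σ, z σ' _ => σ = σ'
  | w σ _ _, x₂ σ' => σ = σ'
  | w _ i _, c i' t => i = i' ∧ t.val ≠ 0
  | w σ i _, z σ' i' => σ = σ' ∧ i = i'
  | _, _ => False

instance : lang.Structure (Config m n) := mkStructure isPoint (fun x => ¬ isPoint x) rel

theorem pt_iff (x : Config m n) : Pt x ↔ isPoint x := Iff.rfl

theorem ln_iff (x : Config m n) : Ln x ↔ ¬ isPoint x := Iff.rfl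

theorem ic_iff (x y : Config m n) : Ic x y ↔ rel x y := Iff.rfl

theorem isInc : IsInc (Config m n) where
  cover x := Classical.em _
  disjoint x h := h.2 h.1
  incidence x y h := by
    rw [ic_iff] at h
    rw [pt_iff, ln_iff]
    cases x <;> cases y <;> simp_all [rel, isPoint]

theorem exists_of_rel_ell {x : Config m n} {Q hQ r} (h : rel x (ell Q hQ r)) :
    ∃ k ∈ Q, x = b k.1 k.2 := by
  cases x <;> simp_all [rel]

theorem exists_of_rel_c {x : Config m n} {i t} (h : rel x (c i t)) : ∃ σ r, x = w σ i r := by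
  cases x <;> simp_all [rel]

theorem exists_of_rel_x₂ {x : Config m n} {σ} (h : rel x (x₂ σ)) : ∃ i r, x = w σ i r := by
  cases x <;> simp_all [rel]

/-- Distinct lines `z σ i` and `z σ' i'` share only `x₁ σ` if `σ = σ'`, and otherwise at most the
point `b i (σ i)`, when `i = i'`. -/
theorem eq_of_rel_z {x y : Config m n} {σ σ' i i'} (h : rel x (z σ i)) (h' : rel x (z σ' i'))
    (k : rel y (z σ i)) (k' : rel y (z σ' i')) (hne : (z σ i : Config m n) ≠ z σ' i') : x = y := by
  cases x <;> cases y <;> (simp_all [rel]; try grind)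

theorem card_le_of_w [DecidableEq (Config m n)] {S : Finset (Config m n)} (hm : 2 ≤ m)
    (σ : ℕ → ℕ) (i : ℕ) (h : ∀ x ∈ S, ∃ r, x = w σ i r) : S.card < m := by
  have : S ⊆ Finset.univ.image (w σ i) := fun x hx => by
    obtain ⟨r, rfl⟩ := h x hx; simp
  have := (Finset.card_le_card this).trans Finset.card_image_le
  simp only [Finset.card_univ, Fintype.card_fin] at this
  omega

/-- A line `ell Q` forces all the lines to belong to the same `Q`, and there are only `n - 1` of
these. A line `c` or `x₂`, together with a line of another kind, confines the points to one block `w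
σ i` of size `m - 1`. What remains are lines `z`, two of which share at most one point. -/
theorem kFree (hm : 2 ≤ m) (hn : 2 ≤ n) : KFree m n (Config m n) := by
  classical
  refine KFree.mk' isInc fun S T hS hT hST hmS hnT => ?_
  have hr : ∀ x ∈ S, ∀ y ∈ T, rel x y := fun x hx y hy =>
    (isInc.ic_iff x y).2 ⟨hS x hx, hST x hx y hy⟩
  obtain ⟨p, hp, q, hq, hpq⟩ := Finset.one_lt_card.1 (show 1 < S.card by omega)
  obtain ⟨u, hu, v, hv, huv⟩ := Finset.one_lt_card.1 (show 1 < T.card by omega)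
  -- no line of the form `ell`
  have hell : ∀ Q hQ r, ell Q hQ r ∉ T := by
    intro Q hQ r hmem
    have hsub : ∀ Q' : Finset (ℕ × ℕ), Q'.card = m → (∀ x ∈ S, ∃ k ∈ Q', x = b k.1 k.2) →
        S = Q'.image fun k => b k.1 k.2 := by
      intro Q' hQ' h
      refine Finset.eq_of_subset_of_card_le (fun x hx => ?_)
        (Finset.card_image_le.trans (hQ'.trans_le hmS))
      obtain ⟨k, hk, rfl⟩ := h x hx
      exact Finset.mem_image_of_mem _ hk
    have hb : ∀ x ∈ S, ∃ k ∈ Q, x = b k.1 k.2 := fun x hx =>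
      exists_of_rel_ell (hr x hx _ hmem)
    have hall : ∀ y ∈ T, ∃ r', y = ell Q hQ r' := by
      intro y hy
      obtain ⟨k, hk, rfl⟩ := hb p hp
      obtain ⟨k', hk', rfl⟩ := hb q hq
      have h1 := hr _ hp y hy
      have h2 := hr _ hq y hy
      cases y with
      | ell Q' hQ' r' =>
        have hb' : ∀ x ∈ S, ∃ k ∈ Q', x = b k.1 k.2 := by
          intro x hx
          have := hr x hx _ hy
          obtain ⟨k, -, rfl⟩ := hb x hx
          exact ⟨k, this, rfl⟩
        have hinj : Function.Injective fun k : ℕ × ℕ => (b k.1 k.2 : Config m n) := by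
          rintro ⟨_, _⟩ ⟨_, _⟩ h; simpa using h
        obtain rfl := Finset.image_injective hinj
          ((hsub Q hQ hb).symm.trans (hsub Q' hQ' hb'))
        exact ⟨r', rfl⟩
      | z σ i =>
        exfalso
        apply hpq
        obtain ⟨rfl, h1⟩ := h1
        obtain ⟨h2, h3⟩ := h2
        rw [← h1, ← h3, h2]
      | _ => exact absurd h1 (by simp [rel])
    have : T ⊆ Finset.univ.image (ell Q hQ) := fun y hy => by
      obtain ⟨r', rfl⟩ := hall y hy; simp
    have := (Finset.card_le_card this).trans Finset.card_image_le
    simp only [Finset.card_univ, Fintype.card_fin] at this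
    omega
  -- no line of the form `c`
  have hc : ∀ i t, c i t ∉ T := by
    intro i t hmem
    have hw : ∀ x ∈ S, ∃ σ r, x = w σ i r := fun x hx =>
      exists_of_rel_c (hr x hx _ hmem)
    obtain ⟨σ₀, r₀, rfl⟩ := hw p hp
    have hex : ∃ y ∈ T, ∀ t', y ≠ c i t' := by
      by_contra! hall
      -- The line `c i 0` has no points, so only `n - 1` of the lines `c i t` can occur.
      have : T ⊆ (Finset.univ.filter fun t : Fin n => t.val ≠ 0).image (c i) := fun y hy => by
        obtain ⟨t', rfl⟩ := hall y hy
        have := hr _ hp _ hy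
        exact Finset.mem_image_of_mem _ (Finset.mem_filter.2 ⟨Finset.mem_univ _, this.2⟩)
      have hle := (Finset.card_le_card this).trans Finset.card_image_le
      have hlt : (Finset.univ.filter fun t : Fin n => t.val ≠ 0).card < (Finset.univ : Finset (Fin n)).card :=
        Finset.card_lt_card (Finset.filter_ssubset.2 ⟨⟨0, by omega⟩, by simp⟩)
      simp only [Finset.card_univ, Fintype.card_fin] at hlt
      omega
    obtain ⟨y, hy, hyc⟩ := hex
    refine (card_le_of_w hm σ₀ i fun x hx => ?_).not_ge hmS
    obtain ⟨σ, r, rfl⟩ := hw x hx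
    have h1 := hr _ hp y hy
    have h2 := hr _ hx y hy
    cases y with
    | c i' t' => exact absurd rfl (h1.1 ▸ hyc t')
    | x₂ σ' => exact ⟨r, by rw [show σ = σ' from h2, show σ₀ = σ' from h1]⟩
    | z σ' i' => exact ⟨r, by rw [show σ = σ' from h2.1, show σ₀ = σ' from h1.1]⟩
    | _ => exact absurd h1 (by simp [rel])
  -- no line of the form `x₂`
  have hx₂ : ∀ σ, x₂ σ ∉ T := by
    intro σ hmem
    have hw : ∀ x ∈ S, ∃ i r, x = w σ i r := fun x hx =>
      exists_of_rel_x₂ (hr x hx _ hmem)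
    have hex : ∃ y ∈ T, y ≠ x₂ σ := by
      by_contra! hall
      exact huv ((hall u hu).trans (hall v hv).symm)
    obtain ⟨y, hy, hyx⟩ := hex
    obtain ⟨i₀, r₀, rfl⟩ := hw p hp
    refine (card_le_of_w hm σ i₀ fun x hx => ?_).not_ge hmS
    obtain ⟨i, r, rfl⟩ := hw x hx
    have h1 := hr _ hp y hy
    have h2 := hr _ hx y hy
    cases y with
    | c i' t' => exact absurd hy (hc _ _)
    | x₂ σ' => exact absurd rfl ((show σ = σ' from h1) ▸ hyx)
    | z σ' i' => exact ⟨r, by rw [show i = i' from h2.2, show i₀ = i' from h1.2]⟩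
    | _ => exact absurd h1 (by simp [rel])
  have hz : ∀ y ∈ T, ∃ σ i, y = z σ i := by
    intro y hy
    have := hr p hp y hy
    cases y with
    | c => exact absurd hy (hc _ _)
    | x₂ => exact absurd hy (hx₂ _)
    | ell => exact absurd hy (hell _ _ _)
    | z σ i => exact ⟨σ, i, rfl⟩
    | _ => cases p <;> exact this.elim
  obtain ⟨σ, i, rfl⟩ := hz u hu
  obtain ⟨σ', i', rfl⟩ := hz v hv
  exact hpq (eq_of_rel_z (hr p hp _ hu) (hr p hp _ hv) (hr q hq _ hu) (hr q hq _ hv) huv)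

end Config

/-! ### The formula `phi` has TP₂ -/

section TP2

variable {m n : ℕ} {M : Type} [lang.Structure M]

theorem realize_phi (x : Fin 2 → M) (y : Fin n → M) :
    (phi m n).Realize (Sum.elim x y) ↔ ∃ u : Fin (m - 1) ⊕ Unit → M,
      @SameType _ M _ (gamma m n) _ id (Sum.elim (Sum.elim x y) u) := by
  let _ := gamma m n
  rw [phi, Formula.realize_iExs]
  simp only [realize_diag]

/-- The parameters of the array. -/
def param (m : ℕ) {n : ℕ} (i j : ℕ) (t : Fin n) : Config m n :=
  if t.val = 0 then Config.b i j else Config.c i t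

/-- Paths through the array are realized in the configuration. -/
theorem sameType_config (σ : ℕ → ℕ) (i : ℕ) :
    @SameType _ (Config m n) _ (gamma m n) _ id
      (Sum.elim (Sum.elim ![Config.x₁ σ, Config.x₂ σ] (param m i (σ i)))
        (Sum.elim (Config.w σ i) fun _ => Config.z σ i)) := by
  let _ := gamma m n
  have hp : ∀ u : GammaDom m n, gammaP m n u ↔ Config.isPoint
      ((Sum.elim (Sum.elim ![Config.x₁ σ, Config.x₂ σ] (param m i (σ i)))
        (Sum.elim (Config.w σ i) fun _ => Config.z σ i) : GammaDom m n → Config m n) u) := by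
    rintro ((j | t) | (r | _))
    · fin_cases j <;> simp [gammaP, Config.isPoint]
    · by_cases h : t.val = 0 <;> simp [gammaP, param, h, Config.isPoint]
    · simp [gammaP, Config.isPoint]
    · simp [gammaP, Config.isPoint]
  refine ⟨?_, hp, fun u => not_congr (hp u), ?_⟩ <;> clear hp
  · rintro ((j | t) | (r | _)) ((j' | t') | (r' | _))
    all_goals try fin_cases j
    all_goals try fin_cases j'
    all_goals try by_cases h : t.val = 0
    all_goals try by_cases h' : t'.val = 0
    all_goals simp_all [param, Fin.ext_iff, eq_comm]
  · rintro ((j | t) | (r | _)) ((j' | t') | (r' | _))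
    all_goals try fin_cases j
    all_goals try fin_cases j'
    all_goals try by_cases h : t.val = 0
    all_goals try by_cases h' : t'.val = 0
    all_goals simp_all [param, Config.rel, Ic, gammaI, Structure.RelMap]

/-- Sufficiently many instances of `phi` in a row of the array are inconsistent. -/
theorem kInconsistent_param (hm : 2 ≤ m) (hn : 2 ≤ n) (hM : KFree m n M)
    (e : Config m n ↪[lang] M) (i : ℕ) :
    Classification.KInconsistent ((n - 1) * m + 1) (phi m n)
      (fun j t => e (param m i j t)) := by
  classical
  let _ := gamma m n
  rintro s hs ⟨x, hx⟩
  replace hx := fun j hj => (realize_phi x fun t => e (param m i j t)).1 (hx j hj)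
  have : Nonempty M := ⟨x 0⟩
  choose! u hu using hx
  let t₀ : Fin n := ⟨0, by omega⟩
  have hadj : ∀ j ∈ s, ∀ p q : GammaDom m n, gammaI m n p q →
      Adj (Sum.elim (Sum.elim x fun t => e (param m i j t)) (u j) p)
        (Sum.elim (Sum.elim x fun t => e (param m i j t)) (u j) q) :=
    fun j hj p q h => (((hu j hj).ic_iff p q).1 h).adj
  have hcol : ∀ j ∈ s, ∀ p : GammaDom m n, gammaP m n p →
      col (Sum.elim (Sum.elim x fun t => e (param m i j t)) (u j) p) = true :=
    fun j hj p h => col_eq_true.2 (((hu j hj).pt_iff p).1 h)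
  have hinj : ∀ j ∈ s, Function.Injective
      (Sum.elim (Sum.elim x fun t => e (param m i j t)) (u j)) :=
    fun j hj p q h => ((hu j hj).eq_iff p q).2 h
  have hcol' : ∀ j ∈ s, ∀ p : GammaDom m n, ¬ gammaP m n p →
      col (Sum.elim (Sum.elim x fun t => e (param m i j t)) (u j) p) = false :=
    fun j hj p h => (hM.ln_iff_col _).1 (((hu j hj).ln_iff p).1 h)
  have hpar : ∀ j (t : Fin n), t ≠ t₀ → e (param m i j t) = e (Config.c i t) := fun j t ht => by
    have : t.val ≠ 0 := fun h => ht (Fin.ext h)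
    rw [param, if_neg this]
  obtain ⟨j₀, hj₀⟩ : s.Nonempty := Finset.card_pos.1 (by omega)
  let W : ℕ → Finset M := fun j => Finset.univ.image fun r => u j (Sum.inl r)
  have hWc : ∀ j ∈ s, (W j).card = m - 1 := fun j hj => by
    rw [Finset.card_image_of_injective, Finset.card_univ, Fintype.card_fin]
    intro r r' h
    simpa using hinj j hj (a₁ := Sum.inr (Sum.inl r)) (a₂ := Sum.inr (Sum.inl r')) h
  -- the lines common to all instances
  let Λ : Finset M := insert (x 1) ((Finset.univ.erase t₀).image fun t => e (Config.c i t))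
  have hΛc : n ≤ Λ.card := by
    rw [Finset.card_insert_of_notMem, Finset.card_image_of_injective,
      Finset.card_erase_of_mem (Finset.mem_univ _), Finset.card_univ, Fintype.card_fin]
    · omega
    · intro t t' h
      simpa using e.injective h
    · intro h
      obtain ⟨t, ht, h⟩ := Finset.mem_image.1 h
      have := hinj j₀ hj₀ (a₁ := Sum.inl (Sum.inr t)) (a₂ := Sum.inl (Sum.inl 1))
        ((hpar _ t (Finset.ne_of_mem_erase ht)).trans h)
      simp at this
  have hΛcol : ∀ y ∈ Λ, col y = false := by
    simp only [Λ, Finset.mem_insert, forall_eq_or_imp, Finset.forall_mem_image]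
    refine ⟨hcol' j₀ hj₀ (Sum.inl (Sum.inl 1)) (by simp [gammaP]), fun t ht => ?_⟩
    rw [col_map, ← Bool.not_eq_true, col_eq_true]
    exact id
  have hWcol : ∀ j ∈ s, ∀ y ∈ W j, col y = true := fun j hj => by
    simp only [W, Finset.forall_mem_image]
    exact fun r _ => hcol j hj (Sum.inr (Sum.inl r)) trivial
  have hΛW : ∀ j ∈ s, ∀ y ∈ Λ, ∀ w ∈ W j, Adj y w := by
    intro j hj
    simp only [Λ, W, Finset.mem_insert, forall_eq_or_imp, Finset.forall_mem_image]
    refine ⟨fun r _ => (hadj j hj (Sum.inr (Sum.inl r)) (Sum.inl (Sum.inl 1)) rfl).symm,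
      fun t ht r _ => ?_⟩
    have ht' := Finset.ne_of_mem_erase ht
    rw [← hpar j t ht']
    exact (hadj j hj (Sum.inr (Sum.inl r)) (Sum.inl (Sum.inr t))
      fun h => ht' (Fin.ext h)).symm
  -- Each `W j` consists of `m - 1` common points of the `n` lines in `Λ`, which do not depend on
  -- `j`; freeness allows no others.
  have hW : ∀ j ∈ s, W j = W j₀ := by
    intro j hj
    refine Finset.eq_of_subset_of_card_le (fun y hy => ?_) ((hWc j₀ hj₀).trans (hWc j hj).symm).le
    exact hM.mem_of_adj (c := false) hΛcol (hWcol j₀ hj₀) (hΛW j₀ hj₀) hΛc (hWc j₀ hj₀).ge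
      (hWcol j hj y hy) fun v hv => hΛW j hj v hv y hy
  -- the lines `z`
  let Z : ℕ → M := fun j => u j (Sum.inr ())
  -- All the lines `Z j` pass through the same `m` points, `x 0` and those of `W j₀`.
  have hZ : (s.image Z).card ≤ n - 1 := by
    by_contra! hcard
    refine hM.free true (insert (x 0) (W j₀)) (s.image Z) ?_ ?_ ?_ ?_
      (show n ≤ _ by omega)
    · simp only [Finset.mem_insert, forall_eq_or_imp]
      exact ⟨hcol j₀ hj₀ (Sum.inl (Sum.inl 0)) rfl, hWcol j₀ hj₀⟩
    · simp only [Finset.forall_mem_image]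
      exact fun j hj => hcol' j hj (Sum.inr (Sum.inr ())) id
    · simp only [Finset.mem_insert, forall_eq_or_imp, Finset.forall_mem_image]
      refine ⟨fun j hj => hadj j hj (Sum.inl (Sum.inl 0)) (Sum.inr (Sum.inr ())) rfl,
        fun w hw j hj => ?_⟩
      rw [← hW j hj] at hw
      obtain ⟨r, -, rfl⟩ := Finset.mem_image.1 hw
      exact hadj j hj (Sum.inr (Sum.inl r)) (Sum.inr (Sum.inr ())) trivial
    · rw [Finset.card_insert_of_notMem, hWc j₀ hj₀]
      · change m ≤ _; omega
      · intro h
        obtain ⟨r, -, h⟩ := Finset.mem_image.1 h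
        have := hinj j₀ hj₀ (a₁ := Sum.inr (Sum.inl r)) (a₂ := Sum.inl (Sum.inl 0)) h
        simp at this
  -- At most `n - 1` lines serve `(n - 1) * m + 1` columns, so one line `z` serves more than `m`:
  -- the `m` columns in `J` and a further one, `j'`.
  obtain ⟨z, -, hz⟩ := Finset.exists_lt_card_fiber_of_mul_lt_card_of_maps_to
    (s := s) (t := s.image Z) (f := Z) (n := m) (fun j hj => Finset.mem_image_of_mem Z hj)
    (lt_of_le_of_lt (Nat.mul_le_mul_right m hZ) (by omega))
  obtain ⟨J, hJ, hJc⟩ := Finset.exists_subset_card_eq hz.le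
  obtain ⟨j', hj', hj'J⟩ := Finset.exists_mem_notMem_of_card_lt_card (hJc.trans_lt hz)
  have hzb : ∀ j ∈ s.filter (Z · = z), Adj (e (Config.b i j)) z := by
    intro j hj
    obtain ⟨hjs, rfl⟩ := Finset.mem_filter.1 hj
    have := hadj j hjs (Sum.inl (Sum.inr t₀)) (Sum.inr (Sum.inr ())) rfl
    rwa [show Sum.elim (Sum.elim x fun t => e (param m i j t)) (u j) (Sum.inl (Sum.inr t₀)) =
      e (Config.b i j) from congrArg e (if_pos rfl)] at this
  let Q : Finset (ℕ × ℕ) := J.image fun j => (i, j)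
  have hQ : Q.card = m := by
    rw [Finset.card_image_of_injective _ (fun a b h => by simpa using h), hJc]
  have hzcol : col z = false := by
    obtain ⟨hjs, rfl⟩ := Finset.mem_filter.1 hj'
    exact hcol' j' hjs (Sum.inr (Sum.inr ())) id
  -- The `n - 1` lines `ell Q r` exhaust the lines through the `m` points given by `J`, so `z` is
  -- one of them. But these miss `b i j'`.
  have hmem : z ∈ Finset.univ.image fun r => e (Config.ell Q hQ r) := by
    refine hM.mem_of_adj (c := true) (S := J.image fun j => e (Config.b i j)) ?_ ?_ ?_ ?_ ?_ hzcol ?_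
    · simp only [Finset.forall_mem_image, col_map]
      exact fun j _ => col_eq_true.2 trivial
    · simp only [Finset.forall_mem_image, col_map]
      exact fun r _ => (Config.isInc.ln_iff_col _).1 id
    · simp only [Finset.forall_mem_image, adj_map]
      exact fun j hj r _ => Ic.adj (show (i, j) ∈ Q from Finset.mem_image_of_mem _ hj)
    · rw [Finset.card_image_of_injective _ (fun a b h => by simpa using e.injective h), hJc]; rfl
    · rw [Finset.card_image_of_injective _ (fun a b h => by simpa using e.injective h),
        Finset.card_univ, Fintype.card_fin]; rfl
    · simp only [Finset.forall_mem_image]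
      exact fun j hj => hzb j (hJ hj)
  obtain ⟨r, -, rfl⟩ := Finset.mem_image.1 hmem
  have := (adj_map e _ _).1 (hzb j' hj')
  have h' : Ic (Config.b i j') (Config.ell Q hQ r) :=
    (Config.isInc.ic_iff _ _).2 ⟨col_eq_true.2 trivial, this⟩
  obtain ⟨j, hj, h⟩ := Finset.mem_image.1 (show (i, j') ∈ Q from h')
  obtain rfl : j = j' := by simpa using h
  exact hj'J hj

/-- The formula `phi` has TP₂. -/
theorem hasTP2_phi (hm : 2 ≤ m) (hn : 2 ≤ n) : Classification.HasTP2 (Tmn m n) (phi m n) := by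
  obtain ⟨H, _, e, hH⟩ := exists_model (m := m) (n := n) (by omega) (by omega) (Config m n)
    (Config.kFree hm hn)
  have : Nonempty H := ⟨e (Config.b 0 0)⟩
  have hpos : 0 < (n - 1) * m := Nat.mul_pos (by omega) (by omega)
  refine ⟨⟨H⟩, (n - 1) * m + 1, fun i j t => e (param m i j t), by omega, fun i => ?_, ?_⟩
  · exact kInconsistent_param hm hn (models_Tmn.1 hH).1 e i
  -- The pair `x₁ σ`, `x₂ σ` solves every instance along `σ`, with `w σ i` and `z σ i` as witnesses
  -- in row `i`.
  · refine fun σ s => ⟨fun k => e (![Config.x₁ σ, Config.x₂ σ] k), fun i _ => ?_⟩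
    let _ := gamma m n
    refine (realize_phi (m := m) (M := H) _ _).2
      ⟨fun k => e (Sum.elim (Config.w σ i) (fun _ => Config.z σ i) k), ?_⟩
    have := (sameType_config (m := m) (n := n) σ i).trans (sameType_map e _)
    convert! this using 1
    ext ((k | k) | (k | k)) <;> rfl

end TP2

end Incidence

namespace Incidence

/-! ### Independence and amalgamation -/

section Indep

variable {m n : ℕ} {M N A C D E : Type} [lang.Structure M] [lang.Structure N] [lang.Structure A]
  [lang.Structure C] [lang.Structure D] [lang.Structure E]

/-- The images of `N` and `A` in `D` meet in the image of `M` only, and there is no incidence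
between them apart from those that involve an element of `M`. -/
structure Indep (β : N ↪[lang] D) (α : A ↪[lang] D) (i : M ↪[lang] N) (j : M ↪[lang] A) :
    Prop where
  agree : ∀ x, β (i x) = α (j x)
  eq : ∀ v u, β v = α u → ∃ x, v = i x ∧ u = j x
  adj : ∀ v u, Adj (β v) (α u) → (∃ x, v = i x) ∨ ∃ x, u = j x

/-- An element of `N` outside the closed copy of `M` has only finitely many neighbours there. A
sequence from `M` almost always adjacent to it is therefore almost everywhere constant, so its class
lies in `M`. -/
theorem indep_upow [Nonempty M] [Nonempty N] (hm : 1 ≤ m) (hn : 1 ≤ n) (hM : IsComplete m n M)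
    (hN : KFree m n N) {J : Type} (U : Ultrafilter J) (h : M ↪[lang] N) :
    Indep (diagEmb U N) (upMap U h) h (diagEmb U M) := by
  classical
  refine ⟨fun x => (upMap_diagEmb h x).symm, fun v u => ?_, fun v u => ?_⟩
  · obtain ⟨f, rfl⟩ := up_surjective U u
    rw [diagEmb_apply, upMap_up, up_eq]
    intro hf
    obtain ⟨j, hj⟩ := hf.exists
    refine ⟨f j, hj, up_eq.2 (hf.mono fun j' hj' => h.injective (hj'.symm.trans hj))⟩
  · obtain ⟨f, rfl⟩ := up_surjective U u
    rw [diagEmb_apply, upMap_up, adj_up]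
    intro hf
    by_contra! hcon
    have hfin : {a | Adj v (h a)}.Finite := by
      by_contra hinf
      obtain ⟨S, hS, hSc⟩ := Set.Infinite.exists_subset_card_eq hinf (sz m n (!col v))
      obtain ⟨x, hx⟩ := hM.closed hN hm hn h v (S.image h) (by simp)
        (by simpa using fun a ha => hS ha) (by rw [Finset.card_image_of_injective _ h.injective, hSc])
      exact hcon.1 x hx.symm
    obtain ⟨a, -, ha⟩ := (Ultrafilter.eventually_exists_mem_iff hfin (P := fun a j => f j = a)).1
      (hf.mono fun j hj => ⟨f j, hj, rfl⟩)
    exact hcon.2 a (up_eq.2 ha)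

/-- Changing the embedding of one of two independent structures. -/
theorem Indep.exists_transfer (hm : 1 ≤ m) (hn : 1 ≤ n) (hA : IsComplete m n A)
    (hD : KFree m n D) (hE : KFree m n E) {β : N ↪[lang] D} {α : A ↪[lang] D} {i : M ↪[lang] N}
    {j : M ↪[lang] A} (h : Indep β α i j) (e e' : A ↪[lang] E) (he : ∀ x, e (j x) = e' (j x)) :
    ∃ (H : Type) (_ : lang.Structure H) (δ : D ↪[lang] H) (α' : A ↪[lang] H), H ⊨ Tmn m n ∧
      (∀ u v, e u = e' v → δ (α u) = α' v) ∧ Indep (δ.comp β) α' i j := by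
  -- `E` is glued to `D` by identifying `e u` with `α u`. Free gluing creates no incidences, so any
  -- contact between `N` and the copy `e'` passes through `α` and is controlled by `h`.
  obtain ⟨G, _, δ, ε, hG, h1, h2, -, h4⟩ := exists_freeAmalgam_of_complete hm hn hA hD hE e α
  obtain ⟨H, _, ζ, hH⟩ := exists_model hm hn G hG
  refine ⟨H, _, ζ.comp δ, (ζ.comp ε).comp e', hH, ?_, ?_, ?_, ?_⟩
  · intro u v huv
    simp only [Embedding.comp_apply]
    rw [← h1, huv]
  · intro x
    simp only [Embedding.comp_apply]
    rw [h.agree, ← h1, he]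
  · intro v u huv
    simp only [Embedding.comp_apply] at huv
    obtain ⟨y, hy, hy'⟩ := h2 _ _ (ζ.injective huv).symm
    obtain ⟨x, rfl, rfl⟩ := h.eq _ _ hy'.symm
    exact ⟨x, rfl, e'.injective (hy.symm.trans (he x))⟩
  · intro v u huv
    simp only [Embedding.comp_apply, adj_map] at huv
    rcases h4 _ _ huv with ⟨a, a', ha, ha'⟩ | ⟨a, a', ha, ha'⟩
    · obtain ⟨y, hy, rfl⟩ := h2 _ _ ha'.symm
      rw [← ha', adj_map] at huv
      rcases h.adj _ _ huv with hx | ⟨x, rfl⟩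
      · exact Or.inl hx
      · exact Or.inr ⟨x, e'.injective (hy.symm.trans (he x))⟩
    · obtain ⟨y, -, hy'⟩ := h2 _ _ ha
      obtain ⟨x, hx, -⟩ := h.eq _ _ hy'.symm
      exact Or.inl ⟨x, hx⟩

/-- Independent amalgamation: two copies of `D` can be glued along `N` and along two independent
copies of `A` inside `C`. -/
theorem Indep.exists_amalgam (hm : 1 ≤ m) (hn : 1 ≤ n) (hN : IsComplete m n N)
    (hA : IsComplete m n A) (hC : KFree m n C) (hD : KFree m n D) {β : N ↪[lang] D}
    {α : A ↪[lang] D} {i : M ↪[lang] N} {j : M ↪[lang] A} (h : Indep β α i j)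
    {α₁ α₀ : A ↪[lang] C} (h' : Indep α₁ α₀ j j) :
    ∃ (H : Type) (_ : lang.Structure H) (δ δ' : D ↪[lang] H) (γ : C ↪[lang] H), H ⊨ Tmn m n ∧
      (∀ u, δ (α u) = γ (α₀ u)) ∧ (∀ u, δ' (α u) = γ (α₁ u)) ∧ ∀ v, δ (β v) = δ' (β v) := by
  classical
  -- The first copy of `D` is glued to `C` along `α₀`. In the result, `N` and the copy `α₁` of `A`
  -- have the same joint quantifier-free type as `N` and `A` in `D`, so a second copy of `D` can be
  -- attached there.
  obtain ⟨F, _, δ, γ, hF, h1, h2, h3, h4⟩ := exists_freeAmalgam_of_complete hm hn hA hD hC α₀ α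
  have hb : ∀ x, δ (β (i x)) = γ (α₁ (j x)) := fun x => by
    rw [h.agree, ← h1, h'.agree]
  have heq : ∀ v u, δ (β v) = γ (α₁ u) ↔ β v = α u := by
    intro v u
    constructor
    · intro hvu
      obtain ⟨y, hy, hy'⟩ := h2 _ _ hvu.symm
      obtain ⟨x, rfl, rfl⟩ := h.eq _ _ hy'.symm
      obtain ⟨x', rfl, hx'⟩ := h'.eq _ _ hy.symm
      rw [h.agree, j.injective hx']
    · intro hvu
      obtain ⟨x, rfl, rfl⟩ := h.eq _ _ hvu
      exact hb x
  have hadj : ∀ v u, Adj (δ (β v)) (γ (α₁ u)) ↔ Adj (β v) (α u) := by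
    have key : ∀ v u, ((∃ x, v = i x) ∨ ∃ x, u = j x) →
        (Adj (δ (β v)) (γ (α₁ u)) ↔ Adj (β v) (α u)) := by
      rintro v u (⟨x, rfl⟩ | ⟨x, rfl⟩)
      · rw [hb, h.agree, adj_map, adj_map, adj_map]
      · rw [← hb, ← h.agree, adj_map]
    refine fun v u => ⟨fun hvu => (key v u ?_).1 hvu, fun hvu => (key v u (h.adj _ _ hvu)).2 hvu⟩
    rcases h4 _ _ hvu with ⟨a, a', ha, ha'⟩ | ⟨a, a', ha, ha'⟩
    · obtain ⟨y, hy, rfl⟩ := h2 _ _ ha'.symm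
      obtain ⟨x, hx, -⟩ := h'.eq _ _ hy.symm
      exact Or.inr ⟨x, hx⟩
    · obtain ⟨y, -, hy'⟩ := h2 _ _ ha
      obtain ⟨x, hx, -⟩ := h.eq _ _ hy'.symm
      exact Or.inl ⟨x, hx⟩
  have hs : SameType (Sum.elim (fun v => δ (β v)) fun u => γ (α₁ u)) (Sum.elim β α) := by
    refine SameType.of_col_adj hF.toIsInc hD.toIsInc ?_ ?_ ?_
    · rintro (v | u) (v' | u')
      · simp [δ.injective.eq_iff]
      · exact heq v u'
      · exact eq_comm.trans ((heq v' u).trans eq_comm)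
      · simp [γ.injective.eq_iff, α.injective.eq_iff, α₁.injective.eq_iff]
    · rintro (v | u) <;> simp [col_map]
    · rintro (v | u) (v' | u')
      · simp [adj_map]
      · exact hadj v u'
      · exact adj_comm.trans ((hadj v' u).trans adj_comm)
      · simp [adj_map]
  -- The union of `N` and `A` need not be complete, so safety is checked on the side of `F`. An
  -- element outside this union has all its neighbours from it in `N` if it lies in `D`, by
  -- independence of `α₁` and `α₀`, and in the copy `α₁` of `A` otherwise. Both parts are closed.
  obtain ⟨G, _, δ', ι, hG, g1, -⟩ := exists_freeAmalgam hD hF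
    (Sum.elim (fun v => δ (β v)) fun u => γ (α₁ u)) (Sum.elim β α) hs (by
      intro x hx T hT hadjT
      by_contra! hcard
      by_cases hxD : ∃ y, δ y = x
      · obtain ⟨y, rfl⟩ := hxD
        have hTβ : ∀ t ∈ T, t ∈ Set.range (δ.comp β) := by
          intro t ht
          obtain ⟨(v | u), rfl⟩ := hT t ht
          · exact ⟨v, rfl⟩
          suffices ∃ x, u = j x by
            obtain ⟨x, rfl⟩ := this
            exact ⟨i x, hb x⟩
          rcases h4 _ _ (hadjT _ ht) with ⟨a, a', ha, ha'⟩ | ⟨a, a', ha, ha'⟩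
          · obtain ⟨z, hz, rfl⟩ := h2 _ _ ha'.symm
            obtain ⟨x, hx, -⟩ := h'.eq _ _ hz.symm
            exact ⟨x, hx⟩
          · obtain ⟨z, rfl, rfl⟩ := h2 _ _ ha
            have hz := hadjT _ ht
            rw [← h1] at hz
            rcases h'.adj u z ((adj_map γ _ _).1 hz).symm with hu | ⟨x, rfl⟩
            · exact hu
            · exact absurd ⟨Sum.inl (i x), by simp [h.agree]⟩ hx
        obtain ⟨v, hv⟩ := hN.closed hF hm hn (δ.comp β) (δ y) T hTβ hadjT hcard
        exact hx ⟨Sum.inl v, hv⟩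
      · obtain ⟨z, rfl⟩ := (h3 x).resolve_left hxD
        have hTα : ∀ t ∈ T, t ∈ Set.range (γ.comp α₁) := by
          intro t ht
          obtain ⟨(v | u), rfl⟩ := hT t ht
          · rcases h4 _ _ (hadjT _ ht) with ⟨a, a', ha, ha'⟩ | ⟨a, a', ha, ha'⟩
            · exact absurd ⟨a, ha⟩ hxD
            · obtain ⟨y, -, hy⟩ := h2 _ _ ha'
              obtain ⟨x, rfl, -⟩ := h.eq _ _ hy.symm
              exact ⟨j x, (hb x).symm⟩
          · exact ⟨u, rfl⟩
        obtain ⟨u, hu⟩ := hA.closed hF hm hn (γ.comp α₁) (γ z) T hTα hadjT hcard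
        exact hx ⟨Sum.inr u, hu⟩)
  obtain ⟨H, _, ζ, hH⟩ := exists_model hm hn G hG
  refine ⟨H, _, (ζ.comp ι).comp δ, ζ.comp δ', (ζ.comp ι).comp γ, hH, fun u => ?_, fun u => ?_,
    fun v => ?_⟩
  · simp only [Embedding.comp_apply, ← h1]
  · simp only [Embedding.comp_apply]
    exact congrArg ζ (g1 (Sum.inr u)).symm
  · simp only [Embedding.comp_apply]
    exact congrArg ζ (g1 (Sum.inl v))

end Indep

/-! ### Embeddings obtained from inclusion of types -/

section Types

variable {N N' κ : Type} [lang.Structure N] [lang.Structure N']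

/-- If a labelling of `N'` satisfies all formulas satisfied by a labelling of `N`, then finite
parts of `N` embed in `N'` compatibly. -/
theorem exists_partial_of_realize [Nonempty N'] (c : κ → N) (c' : κ → N')
    (h : ∀ θ : lang.Formula κ, θ.Realize c → θ.Realize c') (s : Finset N) (t : Finset κ) :
    ∃ g : N → N', SameType (fun x : s => (x : N)) (fun x : s => g x) ∧ ∀ k ∈ t, g (c k) = c' k := by
  classical
  let s₁ := s ∪ t.image c
  let S : lang.Structure s₁ := induced Subtype.val
  -- `θ` says that there is a copy of the finite part `s₁` in which the labels from `t` sit in the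
  -- prescribed places.
  let θ : lang.Formula κ := Formula.iExs s₁ ((diag S).relabel Sum.inr ⊓
    Formula.iInf fun k : t => eqv (Sum.inr ⟨c k, Finset.mem_union_right _
      (Finset.mem_image_of_mem c k.2)⟩) (Sum.inl k.1))
  have hS : SameType (id : s₁ → s₁) (Subtype.val : s₁ → N) :=
    sameType_induced Subtype.val_injective
  have hθ : θ.Realize c := by
    refine Formula.realize_iExs.2 ⟨Subtype.val, ?_⟩
    simp only [Formula.realize_inf, Formula.realize_relabel, Formula.realize_iInf, realize_eqv]
    exact ⟨(realize_diag _).2 hS, fun _ => rfl⟩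
  obtain ⟨y, hy⟩ := Formula.realize_iExs.1 (h θ hθ)
  simp only [Formula.realize_inf, Formula.realize_relabel, Formula.realize_iInf, realize_eqv] at hy
  obtain ⟨hy1, hy2⟩ := hy
  replace hy1 : SameType (id : s₁ → s₁) y := (realize_diag _).1 hy1
  have hext : ∀ x (hx : x ∈ s₁), Function.extend Subtype.val y (fun _ => Classical.arbitrary N') x
      = y ⟨x, hx⟩ := fun x hx => Subtype.val_injective.extend_apply y _ ⟨x, hx⟩
  refine ⟨Function.extend Subtype.val y fun _ => Classical.arbitrary N', ?_, fun k hk => ?_⟩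
  · have := (hS.symm.trans hy1).comp
      fun x : s => (⟨x, Finset.mem_union_left _ x.2⟩ : s₁)
    convert! this using 1
    ext x
    exact hext x _
  · rw [hext _ (Finset.mem_union_right _ (Finset.mem_image_of_mem c hk))]
    exact hy2 ⟨k, hk⟩

end Types

/-- There are no sequences of parameters
with the same limit type, one consistent and the other one pairwise inconsistent. -/
theorem not_exists_sequences {m n : ℕ} (hm : 1 ≤ m) (hn : 1 ≤ n) {M : Type} [lang.Structure M]
    [Nonempty M] (hM : M ⊨ Tmn m n) {α β : Type} [Finite α] (φ : lang.Formula (α ⊕ β)) (c₀ c₁ : ℕ → β → M)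
    (h₀ : Classification.FinConsistent φ c₀)
    (h₁ : ∀ i j, i ≠ j → ¬ ∃ x : α → M, φ.Realize (Sum.elim x (c₁ i)) ∧
      φ.Realize (Sum.elim x (c₁ j)))
    (h : ∀ θ : lang.Formula (β ⊕ M), ∀ᶠ i in Filter.atTop,
      θ.Realize (Sum.elim (c₀ i) id) → θ.Realize (Sum.elim (c₁ i) id)) : False := by
  classical
  let U : Ultrafilter ℕ := Filter.hyperfilter ℕ
  have hU : (U : Filter ℕ) ≤ Filter.atTop := by
    rw [← Nat.cofinite_eq_atTop]; exact Filter.hyperfilter_le_cofinite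
  let A := UPow U M
  let C := UPow U A
  let d : M ↪[lang] A := diagEmb U M
  let b₀ : β → A := fun k => up U fun i => c₀ i k
  let b₁ : β → A := fun k => up U fun i => c₁ i k
  have hA : A ⊨ Tmn m n := models_upow hM
  have hC : C ⊨ Tmn m n := models_upow hA
  obtain ⟨hMf, hMc, -⟩ := models_Tmn.1 hM
  obtain ⟨hAf, hAc, -⟩ := models_Tmn.1 hA
  have hCf := (models_Tmn.1 hC).1
  -- `C` contains `A` twice: as constant sequences, and as classes of sequences from `M`. The two
  -- copies are independent over `M`.
  have hind : Indep (diagEmb U A) (upMap U d) d d := indep_upow hm hn hMc hAf U d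
  -- `X i` solves the first `i + 1` instances, so its class `a` solves all of them; a second limit
  -- then gives `φ` at `a` and the other copy of `b₀`.
  choose X hX using fun i : ℕ => h₀ (Finset.range (i + 1))
  let a : α → A := fun k => up U fun i => X i k
  have hφ : φ.Realize (Sum.elim (fun k => diagEmb U A (a k)) fun k => upMap U d (b₀ k)) := by
    have h2 : ∀ i, φ.Realize (Sum.elim a fun k => d (c₀ i k)) := by
      intro i
      have : ∀ᶠ i' in (U : Filter ℕ), φ.Realize fun s =>
          (Sum.elim (fun k i' => X i' k) (fun k _ => c₀ i k) : α ⊕ β → ℕ → M) s i' := by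
        refine hU ((Filter.eventually_ge_atTop i).mono fun i' hi' => ?_)
        convert! hX i' i (Finset.mem_range.2 (by omega)) using 1
        ext (k | k) <;> rfl
      convert! (realize_up (U := U) φ _).2 this using 1
      ext (k | k) <;> rfl
    have : ∀ᶠ i in (U : Filter ℕ), φ.Realize fun s =>
        (Sum.elim (fun k _ => a k) (fun k i => d (c₀ i k)) : α ⊕ β → ℕ → A) s i := by
      refine Filter.Eventually.of_forall fun i => ?_
      convert! h2 i using 1
      ext (k | k) <;> rfl
    convert! (realize_up (U := U) φ _).2 this using 1
    ext (k | k) <;> rfl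
  have htype : ∀ θ : lang.Formula (β ⊕ M), θ.Realize (Sum.elim b₀ d) → θ.Realize (Sum.elim b₁ d) := by
    intro θ hθ
    have e : ∀ c : ℕ → β → M, θ.Realize (Sum.elim (fun k => up U fun i => c i k) d) ↔
        ∀ᶠ i in (U : Filter ℕ), θ.Realize (Sum.elim (c i) id) := by
      intro c
      have := realize_up (U := U) θ (Sum.elim (fun k i => c i k) fun x _ => x)
      have h1 : (fun s => up U ((Sum.elim (fun k i => c i k) fun x _ => x : β ⊕ M → ℕ → M) s)) =
          Sum.elim (fun k => up U fun i => c i k) d := by ext (k | k) <;> rfl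
      have h2 : ∀ i, (fun s => (Sum.elim (fun k i => c i k) fun x _ => x : β ⊕ M → ℕ → M) s i) =
          Sum.elim (c i) id := fun i => by ext (k | k) <;> rfl
      rw [h1] at this
      simpa only [h2] using this
    rw [e] at hθ ⊢
    filter_upwards [hθ, hU (h θ)] with i h1 h2 using h2 h1
  -- As `b₁` satisfies the type of `b₀` over `M`, some embedding of `A` into an ultrapower of `A`
  -- sends `b₀` to the diagonal image of `b₁` and is diagonal on `M`.
  obtain ⟨J, V, e, he⟩ := exists_embedding_upow _ _ (exists_partial_of_realize _ _ htype)
  have hE : UPow V A ⊨ Tmn m n := models_upow hA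
  obtain ⟨D, _, δ, α', hD, ht, hind'⟩ := hind.exists_transfer hm hn hAc hCf (models_Tmn.1 hE).1 e
    (diagEmb V A) fun x => he (Sum.inr x)
  have hφD : φ.Realize (Sum.elim (fun k => δ (diagEmb U A (a k))) fun k => α' (b₁ k)) := by
    rw [← realize_map hm hn hC hD δ] at hφ
    convert! hφ using 1
    ext (k | k)
    · rfl
    · exact (ht (b₀ k) (b₁ k) (he (Sum.inl k))).symm
  have : Nonempty D := ⟨δ (Classical.arbitrary C)⟩
  obtain ⟨H, _, ε, ε', γ, hH, g1, g2, g3⟩ := hind'.exists_amalgam hm hn hAc hAc hCf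
    (models_Tmn.1 hD).1 hind
  -- In `H` the two copies of `D` share the image of `a`, which solves both instances. This is an
  -- existential statement about `C`, so it descends along the elementary map `γ`.
  have hc : ∃ x : α → C, φ.Realize (Sum.elim x fun k => upMap U d (b₁ k)) ∧
      φ.Realize (Sum.elim x fun k => diagEmb U A (b₁ k)) := by
    let χ : lang.Formula (β ⊕ β) := Formula.iExs α
      (φ.relabel (Sum.elim Sum.inr fun k => Sum.inl (Sum.inl k)) ⊓
        φ.relabel (Sum.elim Sum.inr fun k => Sum.inl (Sum.inr k)))
    have hχ : ∀ (K : Type) [lang.Structure K] (y y' : β → K), χ.Realize (Sum.elim y y') ↔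
        ∃ x : α → K, φ.Realize (Sum.elim x y) ∧ φ.Realize (Sum.elim x y') := by
      intro K _ y y'
      simp only [χ, Formula.realize_iExs, Formula.realize_inf, Formula.realize_relabel,
        Sum.comp_elim]
      rfl
    have h3 : (fun s => γ (Sum.elim (fun k => upMap U d (b₁ k)) (fun k => diagEmb U A (b₁ k)) s)) =
        Sum.elim (fun k => ε (α' (b₁ k))) fun k => ε' (α' (b₁ k)) := by
      ext (k | k)
      · exact (g1 _).symm
      · exact (g2 _).symm
    rw [← hχ, ← realize_map hm hn hC hH γ, h3, hχ]
    refine ⟨fun k => ε (δ (diagEmb U A (a k))), ?_, ?_⟩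
    · rw [← realize_map hm hn hD hH ε] at hφD
      convert! hφD using 1
      ext (k | k) <;> rfl
    · rw [← realize_map hm hn hD hH ε'] at hφD
      convert! hφD using 1
      ext (k | k)
      · exact g3 (a k)
      · rfl
  obtain ⟨x, hx, hx'⟩ := hc
  choose Y hY using fun k => up_surjective U (x k)
  have h2 : ∀ᶠ i in (U : Filter ℕ), φ.Realize fun s =>
      (Sum.elim Y fun k i => d (c₁ i k) : α ⊕ β → ℕ → A) s i := by
    refine (realize_up (U := U) φ _).1 ?_
    convert! hx using 1
    ext (k | k)
    · exact hY k
    · rfl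
  have h3 : ∀ᶠ i in (U : Filter ℕ), φ.Realize fun s =>
      (Sum.elim Y fun k _ => b₁ k : α ⊕ β → ℕ → A) s i := by
    refine (realize_up (U := U) φ _).1 ?_
    convert! hx' using 1
    ext (k | k)
    · exact hY k
    · rfl
  -- The outer limit fixes an index `i`; the inner one, still involving `b₁`, then supplies a later
  -- index `i'`.
  obtain ⟨i, h2, h3⟩ := (h2.and h3).exists
  choose Z hZ using fun k => up_surjective U (Y k i)
  have h4 : ∀ᶠ i' in (U : Filter ℕ), φ.Realize fun s =>
      (Sum.elim Z fun k _ => c₁ i k : α ⊕ β → ℕ → M) s i' := by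
    refine (realize_up (U := U) φ _).1 ?_
    convert! h2 using 1
    ext (k | k)
    · exact hZ k
    · rfl
  have h5 : ∀ᶠ i' in (U : Filter ℕ), φ.Realize fun s =>
      (Sum.elim Z fun k i' => c₁ i' k : α ⊕ β → ℕ → M) s i' := by
    refine (realize_up (U := U) φ _).1 ?_
    convert! h3 using 1
    ext (k | k)
    · exact hZ k
    · rfl
  obtain ⟨i', ⟨h4, h5⟩, hi'⟩ :=
    ((h4.and h5).and (hU (Filter.eventually_gt_atTop i))).exists
  refine h₁ i i' hi'.ne ⟨fun k => Z k i', ?_, ?_⟩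
  · convert! h4 using 1
    ext (k | k) <;> rfl
  · convert! h5 using 1
    ext (k | k) <;> rfl

end Incidence

/-! ### From an SOP₁ tree to two sequences with the same limit type -/

namespace Classification

section Trees

variable {L : FirstOrder.Language.{0, 0}}

/-- The tree conditions defining SOP₁, in a given structure. -/
def IsSOP1Tree {M : Type} [L.Structure M] {α β : Type} (φ : L.Formula (α ⊕ β))
    (a : List Bool → β → M) : Prop :=
  (∀ η : ℕ → Bool, FinConsistent φ (fun i : ℕ => a ((List.range i).map η))) ∧
    ∀ η ν : List Bool, (η ++ [false]) <+: ν →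
      ¬ ∃ x : α → M, φ.Realize (Sum.elim x (a ν)) ∧ φ.Realize (Sum.elim x (a (η ++ [true])))

/-- Consistency of a family of instances does not depend on the structure. -/
theorem finConsistent_subtype {M : Type} [L.Structure M] (S : L.ElementarySubstructure M)
    {α β ι : Type} [Finite α] (φ : L.Formula (α ⊕ β)) (a : ι → β → S)
    (h : FinConsistent φ fun i k => (a i k : M)) : FinConsistent φ a := by
  intro s
  let χ : L.Formula (s × β) := Formula.iExs α (Formula.iInf fun i : s =>
    φ.relabel (Sum.elim Sum.inr fun k => Sum.inl (i, k)))
  have hχ : ∀ (K : Type) [L.Structure K] (y : s × β → K), χ.Realize y ↔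
      ∃ x : α → K, ∀ i : s, φ.Realize (Sum.elim x fun k => y (i, k)) := by
    intro K _ y
    simp only [χ, Formula.realize_iExs, Formula.realize_iInf, Formula.realize_relabel,
      Sum.comp_elim]
    rfl
  obtain ⟨x, hx⟩ := h s
  have : χ.Realize fun p : s × β => (a p.1 p.2 : M) := (hχ M _).2 ⟨x, fun i => hx i i.2⟩
  obtain ⟨x, hx⟩ := (hχ S _).1 ((S.subtype.map_formula χ fun p : s × β => a p.1 p.2).1 this)
  exact ⟨x, fun i hi => hx ⟨i, hi⟩⟩

/-- Countable elementary substructures containing a given countable set. -/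
theorem exists_countable_elementarySubstructure [Countable L.Symbols] {M : Type} [L.Structure M]
    (s : Set M) (hs : s.Countable) :
    ∃ S : L.ElementarySubstructure M, s ⊆ S ∧ Countable S := by
  -- Löwenheim–Skolem in cardinality `ℵ₀` requires `M` to be infinite; a countable `M` serves as its
  -- own substructure.
  by_cases hM : Countable M
  · exact ⟨⊤, fun _ _ => trivial, inferInstance⟩
  · obtain ⟨S, hS, hc⟩ := exists_elementarySubstructure_card_eq L s Cardinal.aleph0 le_rfl
      (by simpa using hs) (by
        rw [Cardinal.lift_id, Cardinal.lift_id]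
        exact Cardinal.mk_le_aleph0_iff.2 ‹Countable L.Symbols›)
      (by
        rw [Cardinal.lift_id, Cardinal.lift_id]
        rw [← Cardinal.mk_le_aleph0_iff, not_le] at hM
        exact hM.le)
    exact ⟨S, hS, Cardinal.mk_le_aleph0_iff.1 (by simpa using hc.le)⟩

/-- A formula with SOP₁ has an SOP₁ tree in a countable model. -/
theorem HasSOP1.exists_countable [Countable L.Symbols] {T : L.Theory} {α β : Type} [Finite α]
    [Countable β] {φ : L.Formula (α ⊕ β)} (h : HasSOP1 T φ) :
    ∃ (M : Type) (_ : L.Structure M) (a : List Bool → β → M),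
      Countable M ∧ Nonempty M ∧ M ⊨ T ∧ IsSOP1Tree φ a := by
  obtain ⟨M, a, h1, h2⟩ := h
  obtain ⟨S, hS, hc⟩ := exists_countable_elementarySubstructure (L := L)
    (Set.range fun p : List Bool × β => a p.1 p.2) (Set.countable_range _)
  have hmem : ∀ s k, a s k ∈ S := fun s k => hS ⟨(s, k), rfl⟩
  refine ⟨S, inferInstance, fun s k => ⟨a s k, hmem s k⟩, hc, inferInstance,
    ElementarySubstructure.theory_model, ?_, ?_⟩
  · intro η
    exact finConsistent_subtype S φ _ (h1 η)
  · rintro η ν hν ⟨x, hx, hx'⟩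
    refine h2 η ν hν ⟨fun k => x k, ?_, ?_⟩
    · rw [← S.subtype.map_formula] at hx
      convert! hx using 1
      ext (k | k) <;> rfl
    · rw [← S.subtype.map_formula] at hx'
      convert! hx' using 1
      ext (k | k) <;> rfl

/-- From an SOP₁ tree in a countable structure one obtains two sequences of parameters with the
same limit type, one consistent and the other one pairwise inconsistent. -/
theorem IsSOP1Tree.exists_sequences [Countable L.Symbols] {M : Type} [L.Structure M] [Countable M]
    {α β : Type} [Countable β] {φ : L.Formula (α ⊕ β)} {a : List Bool → β → M}
    (h : IsSOP1Tree φ a) : ∃ c₀ c₁ : ℕ → β → M, FinConsistent φ c₀ ∧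
      (∀ i j, i ≠ j → ¬ ∃ x : α → M, φ.Realize (Sum.elim x (c₁ i)) ∧
        φ.Realize (Sum.elim x (c₁ j))) ∧
      ∀ θ : L.Formula (β ⊕ M), ∀ᶠ i in Filter.atTop,
        θ.Realize (Sum.elim (c₀ i) id) → θ.Realize (Sum.elim (c₁ i) id) := by
  classical
  obtain ⟨θ, hθ⟩ := exists_surjective_nat (L.Formula (β ⊕ M))
  have hpig : ∀ (s : List Bool) (i : ℕ), ∃ k l, k < l ∧ ∀ t < i,
      (θ t).Realize (Sum.elim (a (s ++ List.replicate l false ++ [true])) id) →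
        (θ t).Realize (Sum.elim (a (s ++ List.replicate k false ++ [true])) id) := by
    intro s i
    -- The first `i` formulas have finitely many truth patterns, so two of the nodes `s⌢0^k⌢1`
    -- satisfy the same ones.
    obtain ⟨k, l, hkl, heq⟩ := Finite.exists_ne_map_eq_of_infinite fun (k : ℕ) (t : Fin i) =>
      (θ t).Realize (Sum.elim (a (s ++ List.replicate k false ++ [true])) id)
    rcases hkl.lt_or_gt with hlt | hlt
    · exact ⟨k, l, hlt, fun t ht => (congrFun heq ⟨t, ht⟩).mpr⟩
    · exact ⟨l, k, hlt, fun t ht => (congrFun heq ⟨t, ht⟩).mp⟩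
  choose K R hKR hagree using hpig
  -- The branch follows the longer block of zeros, giving `c₀`; the shorter block leads to the side
  -- node for `c₁`.
  let node : ℕ → List Bool := fun i => Nat.rec []
    (fun i s => s ++ List.replicate (R s i) false ++ [true]) i
  have hnode : ∀ i, node (i + 1) = node i ++ List.replicate (R (node i) i) false ++ [true] :=
    fun _ => rfl
  have hpre : ∀ i j, i ≤ j → node i <+: node j := by
    intro i j hij
    induction hij with
    | refl => exact List.prefix_rfl
    | step _ ih =>
      refine ih.trans ?_
      rw [Nat.succ_eq_add_one, hnode, List.append_assoc]
      exact List.prefix_append _ _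
  have hlen : ∀ i, i ≤ (node i).length := by
    intro i
    induction i with
    | zero => exact Nat.zero_le _
    | succ i ih => rw [hnode]; simp only [List.length_append, List.length_singleton]; omega
  -- By `hlen` the entry at position `k` exists in `node (k + 1)`, so the default value never
  -- occurs.
  let η : ℕ → Bool := fun k => (node (k + 1)).getD k false
  have hη : ∀ i, (List.range (node i).length).map η = node i := by
    intro i
    refine List.ext_getElem (by simp) fun k h1 h2 => ?_
    have h3 : k < (node (k + 1)).length := hlen (k + 1)
    simp only [List.getElem_map, List.getElem_range, η]
    rw [List.getD_eq_getElem _ _ h3]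
    rcases le_total (k + 1) i with hki | hki
    · exact (hpre _ _ hki).getElem h3
    · exact ((hpre _ _ hki).getElem h2).symm
  refine ⟨fun i => a (node (i + 1)),
    fun i => a (node i ++ List.replicate (K (node i) i) false ++ [true]), ?_, ?_, ?_⟩
  · intro s
    obtain ⟨x, hx⟩ := h.1 η (s.image fun i => (node (i + 1)).length)
    refine ⟨x, fun i hi => ?_⟩
    have := hx _ (Finset.mem_image_of_mem _ hi)
    simpa only [hη] using this
  · have key : ∀ i j, i < j → ¬ ∃ x : α → M,
        φ.Realize (Sum.elim x (a (node j ++ List.replicate (K (node j) j) false ++ [true]))) ∧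
        φ.Realize (Sum.elim x (a (node i ++ List.replicate (K (node i) i) false ++ [true]))) := by
      intro i j hij
      -- Since `K < R`, the branch goes on with another zero at the place where the side node of
      -- stage `i` takes a one, and the side node of stage `j` lies above the branch at that point.
      refine h.2 _ _ (List.IsPrefix.trans ?_ ((hpre (i + 1) j hij).trans ?_))
      · rw [hnode, List.append_assoc, List.append_assoc, List.prefix_append_right_inj]
        refine List.IsPrefix.trans ?_ (List.prefix_append _ _)
        rw [← List.replicate_succ']
        exact ⟨List.replicate (R (node i) i - (K (node i) i + 1)) false, by
          rw [List.replicate_append_replicate, Nat.add_sub_cancel' (hKR (node i) i)]⟩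
      · rw [List.append_assoc]; exact List.prefix_append _ _
    rintro i j hij ⟨x, hx, hx'⟩
    rcases hij.lt_or_gt with hlt | hlt
    · exact key i j hlt ⟨x, hx', hx⟩
    · exact key j i hlt ⟨x, hx, hx'⟩
  · intro ψ
    obtain ⟨t, rfl⟩ := hθ ψ
    exact (Filter.eventually_gt_atTop t).mono fun i hi => hagree (node i) i t hi

end Trees

end Classification

/-! ### NSOP₁ and the main theorem -/

namespace Incidence

instance : Countable lang.Symbols := by
  have : ∀ k, Countable (Rel k) := fun k =>
    Function.Injective.countable (f := fun r : Rel k => (match r with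
      | .P => 0
      | .L => 1
      | .I => 2 : ℕ)) (by rintro (_ | _ | _) r' <;> cases r' <;> simp)
  have : ∀ k, Countable (lang.Relations k) := this
  have : ∀ k, Countable (lang.Functions k) := fun k => inferInstanceAs (Countable Empty)
  exact inferInstanceAs (Countable ((Σ k, lang.Functions k) ⊕ Σ k, lang.Relations k))

/-- The theory `Tmn` is NSOP₁. -/
theorem isNSOP1_Tmn {m n : ℕ} (hm : 1 ≤ m) (hn : 1 ≤ n) : Classification.IsNSOP1 (Tmn m n) := by
  intro p q φ h
  obtain ⟨M, _, a, _, _, hM, ha⟩ := h.exists_countable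
  obtain ⟨c₀, c₁, h1, h2, h3⟩ := ha.exists_sequences
  exact not_exists_sequences hm hn hM φ c₀ c₁ h1 h2 h3

end Incidence

end

theorem mainTheorem5 (m n : ℕ) (hm : 2 ≤ m) (hn : 2 ≤ n) :
    ¬ Classification.IsSimple (Incidence.Tmn m n) ∧
    Classification.IsProperlyNSOP1 (Incidence.Tmn m n) ∧
    Classification.HasTP2 (Incidence.Tmn m n) (Incidence.phi m n) := by
  have htp := Incidence.hasTP2_phi hm hn
  have hns : ¬ Classification.IsSimple (Incidence.Tmn m n) := fun h => h _ _ _ htp.hasTP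
  exact ⟨hns, ⟨Incidence.isNSOP1_Tmn (by omega) (by omega), hns⟩, htp⟩
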